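/- Let $n,m\ge 1$, $0\le\alpha<mn$, $1<p_1,\dots,p_m<\infty$, $\frac1p=\frac1{p_1}+\cdots+\frac1{p_m}$, $\frac1q=\frac1p-\frac{\alpha}{n}$, and suppose that $\max_i p_i\le q<\infty$. A weight is a non-negative locally integrable function on $\mathbb{R}^n$. For Lebesgue measurable functions $f_1,\dots,f_m$ on $\mathbb{R}^n$, the multilinear fractional maximal function is $$\mathcal{M}_\alpha(f_1,\dots,f_m)(x)=\sup_{Q\ni x}\prod_{i=1}^m\frac{1}{|Q|^{1-\alpha/(mn)}}\int_Q|f_i(y)|\,dy ,$$ where the supremum is over all cubes $Q\subset\mathbb{R}^n$ with sides parallel to the axes that contain $x$. For weights $w_1,\dots,w_m,v$ put $\sigma_i=w_i^{1-p_i'}$, where $1/p_i+1/p_i'=1$ (so $\sigma_i=\infty$ where $w_i=0$), $\sigma_i(Q)=\int_Q\sigma_i\,dx$, and $$[\vec w,v]_{S_{\vec P,q}}=\sup_{Q}\frac{\left(\int_Q\mathcal{M}_\alpha(\sigma_1 1_Q,\dots,\sigma_m 1_Q)^q\,v\,dx\right)^{1/q}}{\prod_{i=1}^m\sigma_i(Q)^{1/p_i}}\in[0,\infty],$$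 the supremum being over all cubes $Q\subset\mathbb{R}^n$, with the convention that the quotient is $\infty$ if its numerator is $\infty$ (even if the denominator is $\infty$ as well). Then $\mathcal{M}_\alpha$ is bounded from $L^{p_1}(w_1)\times\cdots\times L^{p_m}(w_m)$ to $L^q(v)$ if and only if $[\vec w,v]_{S_{\vec P,q}}<\infty$. Moreover, let $\|\mathcal{M}_\alpha\|\in[0,\infty]$ be the infimum of the constants $K$ with $\|\mathcal{M}_\alpha(\vec f)\|_{L^q(v)}\le K\prod_{i=1}^m\|f_i\|_{L^{p_i}(w_i)}$ for all Lebesgue measurable $f_i\in L^{p_i}(w_i)$. Then there are constants $0<c\le C<\infty$, depending only on $n$, $m$, $\alpha$ and $p_1,\dots,p_m$, such that for all weights $w_1,\dots,w_m,v$ $$c\,[\vec w,v]_{S_{\vec P,q}}\le\|\mathcal{M}_\alpha\|\le C\,[\vec w,v]_{S_{\vec P,q}} .$$ -/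

import Mathlib

open MeasureTheory
open scoped ENNReal NNReal

noncomputable section

namespace MultilinearSawyer

/-- A cube in `ℝⁿ` with sides parallel to the axes, with corner `a` and side length `l > 0`.
Taking the cubes closed, half-open or open does not affect any of the notions below. -/
def IsCube {n : ℕ} (Q : Set (Fin n → ℝ)) : Prop :=
  ∃ (a : Fin n → ℝ) (l : ℝ), 0 < l ∧ Q = Set.Icc a (fun j => a j + l)

/-- A weight: a non-negative locally integrable function on `ℝⁿ`. -/
def IsWeight {n : ℕ} (w : (Fin n → ℝ) → ℝ) : Prop :=
  (∀ x, 0 ≤ w x) ∧ LocallyIntegrable w volume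

/-- The measure `w dx`. -/
def weightMeasure {n : ℕ} (w : (Fin n → ℝ) → ℝ) : Measure (Fin n → ℝ) :=
  volume.withDensity (fun x => ENNReal.ofReal (w x))

/-- The dual weight `σ = w ^ (1 - p')`, with values in `[0, ∞]`; it is `∞` where `w = 0`. -/
def dualWeight {n : ℕ} (p : ℝ) (w : (Fin n → ℝ) → ℝ) (x : Fin n → ℝ) : ℝ≥0∞ :=
  ENNReal.ofReal (w x) ^ (1 - p.conjExponent)

/-- The multilinear fractional maximal function
`sup_{Q ∋ x} ∏ i, |Q| ^ (-(1 - α / (m n))) * ∫_Q |f i|`.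
The functions may take real or `[0, ∞]` values; `‖·‖ₑ` is the absolute value, as an element
of `[0, ∞]`. -/
def fracMaximal {n m : ℕ} {E : Type*} [ENorm E] (α : ℝ) (f : Fin m → (Fin n → ℝ) → E)
    (x : Fin n → ℝ) : ℝ≥0∞ :=
  ⨆ (Q : Set (Fin n → ℝ)) (_ : IsCube Q) (_ : x ∈ Q),
    ∏ i, (∫⁻ y in Q, ‖f i y‖ₑ) / volume Q ^ (1 - α / ((m : ℝ) * (n : ℝ)))

/-- The tuple `f` belongs to `L^{p_1}(w_1) × ⋯ × L^{p_m}(w_m)`. The functions are required to be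
Lebesgue measurable (not only with respect to `w_i dx`, which says less where `w_i = 0`), so that
the integrals in the maximal function make sense. -/
def MemDomain {n m : ℕ} (P : Fin m → ℝ) (w f : Fin m → (Fin n → ℝ) → ℝ) : Prop :=
  ∀ i, AEMeasurable (f i) volume ∧ MemLp (f i) (ENNReal.ofReal (P i)) (weightMeasure (w i))

/-- The norm inequality `‖𝓜_α(f)‖_{L^q(v)} ≤ C ∏ i, ‖f i‖_{L^{p_i}(w_i)}` for all `f` in the
product space. -/
def HasNormBound {n m : ℕ} (α : ℝ) (P : Fin m → ℝ) (q : ℝ)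
    (w : Fin m → (Fin n → ℝ) → ℝ) (v : (Fin n → ℝ) → ℝ) (C : ℝ≥0∞) : Prop :=
  ∀ f : Fin m → (Fin n → ℝ) → ℝ, MemDomain P w f →
    eLpNorm (fracMaximal α f) (ENNReal.ofReal q) (weightMeasure v) ≤
      C * ∏ i, eLpNorm (f i) (ENNReal.ofReal (P i)) (weightMeasure (w i))

/-- `𝓜_α` is bounded from `L^{p_1}(w_1) × ⋯ × L^{p_m}(w_m)` to `L^q(v)`: it maps the product
space into `L^q(v)` and satisfies the norm inequality with a finite constant. -/
def IsBoundedMaximal {n m : ℕ} (α : ℝ) (P : Fin m → ℝ) (q : ℝ)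
    (w : Fin m → (Fin n → ℝ) → ℝ) (v : (Fin n → ℝ) → ℝ) : Prop :=
  (∀ f : Fin m → (Fin n → ℝ) → ℝ, MemDomain P w f →
    MemLp (fracMaximal α f) (ENNReal.ofReal q) (weightMeasure v)) ∧
  ∃ C : ℝ≥0, HasNormBound α P q w v C

/-- The operator norm of `𝓜_α` from `L^{p_1}(w_1) × ⋯ × L^{p_m}(w_m)` to `L^q(v)`; it is `∞` if
no finite constant works. -/
def maximalNorm {n m : ℕ} (α : ℝ) (P : Fin m → ℝ) (q : ℝ)
    (w : Fin m → (Fin n → ℝ) → ℝ) (v : (Fin n → ℝ) → ℝ) : ℝ≥0∞ :=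
  sInf {C : ℝ≥0∞ | HasNormBound α P q w v C}

/-- The numerator `(∫_Q 𝓜_α(σ_1 1_Q, …, σ_m 1_Q) ^ q v dx) ^ (1 / q)` of the testing quotient. -/
def testNum {n m : ℕ} (α : ℝ) (P : Fin m → ℝ) (q : ℝ)
    (w : Fin m → (Fin n → ℝ) → ℝ) (v : (Fin n → ℝ) → ℝ) (Q : Set (Fin n → ℝ)) : ℝ≥0∞ :=
  (∫⁻ x in Q, fracMaximal α (fun i => Q.indicator (dualWeight (P i) (w i))) x ^ q *
    ENNReal.ofReal (v x)) ^ (1 / q)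

/-- The denominator `∏ i, σ_i(Q) ^ (1 / p_i)` of the testing quotient. -/
def testDen {n m : ℕ} (P : Fin m → ℝ) (w : Fin m → (Fin n → ℝ) → ℝ)
    (Q : Set (Fin n → ℝ)) : ℝ≥0∞ :=
  ∏ i, (∫⁻ x in Q, dualWeight (P i) (w i) x) ^ (1 / P i)

open Classical in
/-- The multilinear Sawyer testing constant `[w, v]_{S_{P, q}}`. The denominators are positive.
The quotient is `∞` if its numerator is `∞`, also where some `σ_i(Q) = ∞`; that is, `∞ / ∞ = ∞`
(in Mathlib `∞ / ∞ = 0`). -/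
def sawyerConst {n m : ℕ} (α : ℝ) (P : Fin m → ℝ) (q : ℝ)
    (w : Fin m → (Fin n → ℝ) → ℝ) (v : (Fin n → ℝ) → ℝ) : ℝ≥0∞ :=
  ⨆ (Q : Set (Fin n → ℝ)) (_ : IsCube Q),
    if testNum α P q w v Q = ∞ then ∞ else testNum α P q w v Q / testDen P w Q

end MultilinearSawyer

end

/-! The lower bound is obtained by inserting the dual weights `1_Q σ_i` into the norm inequality,
since `σ_i ^ p_i w_i = σ_i`. If some `σ_i` is not integrable on `Q`, truncations of the dual weights
are inserted instead (`HasNormBound.setLIntegral_fracMaximal_le`), and a comparison of exponents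
shows that `v = 0` almost everywhere on `Q` (`HasNormBound.weightMeasure_eq_zero`).

For the upper bound, write `f_i = g_i σ_i`, so that `‖f_i‖_{L^{p_i}(w_i)} = ‖g_i‖_{L^{p_i}(σ_i)}`.
Assume first that the supremum is taken over the cubes of one dyadic grid. For `k ∈ ℤ^m`, let
`𝒟_k` be the family of the cubes `Q` on which the `σ_i`-average of `g_i` is about `2 ^ k_i` for
every `i`. On these cubes the product of the averages of the `f_i` is, up to a constant,
`2 ^ (k_1 + ⋯ + k_m)` times the corresponding product for the `σ_i`, and every such cube lies in a
maximal cube `R` of `𝒟_k`. Hence (`familySup_rpow_le`)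
`𝓜(f) ^ q ≲ ∑_k 2 ^ (q (k_1 + ⋯ + k_m)) ∑_R 1_R 𝓜(1_R σ_1, …, 1_R σ_m) ^ q`.
Integrating against `v`, the testing condition bounds the terms by `∏ i, σ_i(R) ^ (q / p_i)`.
Since `q ≥ p_i` and the cubes `R` are disjoint, their sum over `R` is at most
`∏ i, σ_i(Ω_{i, k_i}) ^ (q / p_i)`, where `Ω_{i, k}` is the set on which the dyadic maximal function
of `g_i` with respect to `σ_i` exceeds `2 ^ k`. The sum over `k` now factors, again by `q ≥ p_i` each
factor is at most `(∑_k 2 ^ (k p_i) σ_i(Ω_{i, k})) ^ (q / p_i)`, and the dyadic maximal theorem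
(`IsNestedFamily.tsum_levelFamily_le`) bounds it by the norm of `g_i`. This is
`lintegral_familySup_le`, in which only the nestedness of dyadic cubes is used.

The general case follows by the one-third trick (`exists_dyadicCube_superset`): every cube of side
length at most `2 ^ N / 6` lies in a dyadic cube of comparable size in one of the `2 ^ n` grids with
origins in `{0, 2 ^ N / 3}ⁿ`. The bounds do not depend on the grid, and Fatou's lemma gives the
limit `N → ∞`. -/

namespace MultilinearSawyer

/-! ### Sums and products in `[0, ∞]` -/

lemma tsum_rpow_le_rpow_tsum {κ : Type*} (a : κ → ℝ≥0∞) {s : ℝ} (hs : 1 ≤ s) :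
    ∑' j, a j ^ s ≤ (∑' j, a j) ^ s := by
  have split (x : ℝ≥0∞) : x ^ s = x * x ^ (s - 1) := by
    conv_rhs => rw [← ENNReal.rpow_one x, ← ENNReal.rpow_mul, one_mul]
    rw [← ENNReal.rpow_add_of_nonneg _ _ zero_le_one (by linarith)]
    congr 1; ring
  calc ∑' j, a j ^ s = ∑' j, a j * a j ^ (s - 1) := by simp_rw [split]
    _ ≤ ∑' j, a j * (∑' j, a j) ^ (s - 1) := by
        gcongr with j
        exact ENNReal.le_tsum j
    _ = (∑' j, a j) ^ s := by rw [ENNReal.tsum_mul_right, ← split]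

/-- Only one of the factors is needed to sum the series; the others are bounded by their sums. -/
lemma tsum_prod_rpow_le {κ ι : Type*} [Fintype ι] [Nonempty ι] (a : ι → κ → ℝ≥0∞) {s : ι → ℝ}
    (hs : ∀ i, 1 ≤ s i) :
    ∑' j, ∏ i, a i j ^ s i ≤ ∏ i, (∑' j, a i j) ^ s i := by
  classical
  obtain ⟨i₀⟩ := ‹Nonempty ι›
  have h0 : i₀ ∈ (Finset.univ : Finset ι) := Finset.mem_univ _
  calc ∑' j, ∏ i, a i j ^ s i
      = ∑' j, a i₀ j ^ s i₀ * ∏ i ∈ Finset.univ.erase i₀, a i j ^ s i := by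
        exact tsum_congr fun j => (Finset.mul_prod_erase _ (fun i => a i j ^ s i) h0).symm
    _ ≤ ∑' j, a i₀ j ^ s i₀ * ∏ i ∈ Finset.univ.erase i₀, (∑' j, a i j) ^ s i := by
        gcongr with j i
        · linarith [hs i]
        · exact ENNReal.le_tsum j
    _ ≤ (∑' j, a i₀ j) ^ s i₀ * ∏ i ∈ Finset.univ.erase i₀, (∑' j, a i j) ^ s i := by
        rw [ENNReal.tsum_mul_right]
        gcongr
        exact tsum_rpow_le_rpow_tsum _ (hs i₀)
    _ = _ := Finset.mul_prod_erase _ (fun i => (∑' j, a i j) ^ s i) h0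

lemma tsum_pi_prod_le {κ ι : Type*} [Fintype ι] (a : ι → κ → ℝ≥0∞) :
    ∑' k : ι → κ, ∏ i, a i (k i) ≤ ∏ i, ∑' j, a i j := by
  classical
  refine ENNReal.summable.tsum_le_of_sum_le fun F => ?_
  calc ∑ k ∈ F, ∏ i, a i (k i)
      ≤ ∑ k ∈ Fintype.piFinset (fun i => F.image (· i)), ∏ i, a i (k i) := by
        refine Finset.sum_le_sum_of_subset fun k hk => ?_
        exact Fintype.mem_piFinset.2 fun i => Finset.mem_image_of_mem _ hk
    _ = ∏ i, ∑ j ∈ F.image (· i), a i j := (Finset.prod_univ_sum _ _).symm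
    _ ≤ _ := by gcongr with i; exact ENNReal.sum_le_tsum _

/-- The constant in `tsum_zpow_lt_le`, the sum of a geometric series. -/
noncomputable def levelConst (p : ℝ) : ℝ≥0∞ :=
  2 ^ p * (1 - 2 ^ (-(p - 1)))⁻¹

lemma levelConst_ne_top {p : ℝ} (hp : 1 < p) : levelConst p ≠ ∞ := by
  refine ENNReal.mul_ne_top (ENNReal.rpow_ne_top_of_nonneg (by linarith) (by simp)) ?_
  refine ENNReal.inv_ne_top.2 (tsub_pos_of_lt ?_).ne'
  rw [ENNReal.rpow_neg]
  exact ENNReal.inv_lt_one.2 (ENNReal.one_lt_rpow (by norm_num) (by linarith))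

lemma levelConst_pos (p : ℝ) : 0 < levelConst p := by
  refine ENNReal.mul_pos (ENNReal.rpow_pos (by simp) (by simp)).ne' ?_
  exact ENNReal.inv_ne_zero.2 (ne_top_of_le_ne_top ENNReal.one_ne_top tsub_le_self)

lemma two_zpow_rpow (k : ℤ) (p : ℝ) : ((2 : ℝ≥0∞) ^ k) ^ p = 2 ^ ((k : ℝ) * p) := by
  rw [ENNReal.rpow_mul, ENNReal.rpow_intCast]

/-- The dyadic levels below `u` weighted by their `(p - 1)`-st powers form a geometric series
dominated by its last term, which is at most `u ^ (p - 1)`. -/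
lemma tsum_zpow_lt_le {p : ℝ} (hp : 1 < p) (u : ℝ≥0∞) :
    ∑' k : ℤ, (2 ^ (k + 1)) ^ p * (2 ^ k : ℝ≥0∞)⁻¹ * {y : ℝ≥0∞ | 2 ^ k < y}.indicator id u
      ≤ levelConst p * u ^ p := by
  rcases eq_or_ne u 0 with rfl | h0
  · simp
  rcases eq_or_ne u ∞ with rfl | ht
  · rw [ENNReal.top_rpow_of_pos (by linarith), ENNReal.mul_top (levelConst_pos p).ne']
    exact le_top
  obtain ⟨K, hK1, hK2⟩ := ENNReal.exists_mem_Ioc_zpow h0 ht (y := 2) (by norm_num) (by simp)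
  have inj : Function.Injective (fun i : ℕ => K - (i : ℤ)) := fun a b h => by
    simp only at h; omega
  rw [← inj.tsum_eq]
  · have term (i : ℕ) : (2 ^ (K - (i : ℤ) + 1)) ^ p * (2 ^ (K - (i : ℤ)) : ℝ≥0∞)⁻¹ *
        {y : ℝ≥0∞ | 2 ^ (K - (i : ℤ)) < y}.indicator id u
          ≤ 2 ^ p * (2 ^ K) ^ (p - 1) * u * (2 ^ (-(p - 1))) ^ i := by
      have e : (2 ^ (K - (i : ℤ) + 1)) ^ p * (2 ^ (K - (i : ℤ)) : ℝ≥0∞)⁻¹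
          = 2 ^ p * (2 ^ K) ^ (p - 1) * (2 ^ (-(p - 1))) ^ i := by
        rw [two_zpow_rpow, two_zpow_rpow, ← ENNReal.rpow_intCast, ← ENNReal.rpow_neg,
          ← ENNReal.rpow_natCast, ← ENNReal.rpow_mul]
        rw [← ENNReal.rpow_add _ _ (by simp) (by simp), ← ENNReal.rpow_add _ _ (by simp) (by simp),
          ← ENNReal.rpow_add _ _ (by simp) (by simp)]
        congr 1
        push_cast; ring
      rw [e, mul_right_comm _ u]
      gcongr
      exact Set.indicator_le_self' (fun _ _ => zero_le) u
    refine (ENNReal.tsum_le_tsum term).trans ?_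
    rw [ENNReal.tsum_mul_left, ENNReal.tsum_geometric]
    have : ((2 : ℝ≥0∞) ^ K) ^ (p - 1) * u ≤ u ^ p := by
      calc ((2 : ℝ≥0∞) ^ K) ^ (p - 1) * u ≤ u ^ (p - 1) * u ^ (1 : ℝ) := by
            rw [ENNReal.rpow_one]; gcongr
        _ = u ^ p := by
            rw [← ENNReal.rpow_add _ _ h0 ht]; congr 1; ring
    calc 2 ^ p * (2 ^ K) ^ (p - 1) * u * (1 - 2 ^ (-(p - 1)))⁻¹
        = levelConst p * ((2 ^ K) ^ (p - 1) * u) := by unfold levelConst; ring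
      _ ≤ _ := by gcongr
  · intro k hk
    rw [Function.mem_support] at hk
    have hku : (2 : ℝ≥0∞) ^ k < u := by
      by_contra h
      exact hk (by rw [Set.indicator_of_notMem (by exact h), mul_zero])
    have : k < K + 1 := by
      by_contra h
      exact absurd (hku.trans_le hK2)
        (not_lt.2 (ENNReal.zpow_le_of_le (by norm_num) (not_lt.1 h)))
    exact ⟨(K - k).toNat, by grind⟩

/-! ### Nested families of sets -/

/-- A countable family of measurable sets, any two of which are nested or disjoint, and in which
every subfamily has enough maximal members. Dyadic cubes of bounded size are an example. -/
structure IsNestedFamily {X : Type*} [MeasurableSpace X] (𝒟 : Set (Set X)) : Prop where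
  countable : 𝒟.Countable
  measurableSet : ∀ Q ∈ 𝒟, MeasurableSet Q
  nested : ∀ Q ∈ 𝒟, ∀ R ∈ 𝒟, Q ⊆ R ∨ R ⊆ Q ∨ Disjoint Q R
  exists_maximal : ∀ T ⊆ 𝒟, ∀ Q ∈ T, ∃ R, Q ⊆ R ∧ Maximal (· ∈ T) R

/-- The maximal members of a family of sets. -/
def maximals {X : Type*} (T : Set (Set X)) : Set (Set X) := {R | Maximal (· ∈ T) R}

lemma maximals_subset {X : Type*} (T : Set (Set X)) : maximals T ⊆ T := fun _ h => h.prop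

/-- The function `sup_{Q ∈ 𝒮, x ∈ Q} c Q`. -/
noncomputable def familySup {X : Type*} (𝒮 : Set (Set X)) (c : Set X → ℝ≥0∞) (x : X) : ℝ≥0∞ :=
  ⨆ Q ∈ 𝒮, Q.indicator (fun _ => c Q) x

lemma le_familySup {X : Type*} {𝒮 : Set (Set X)} (c : Set X → ℝ≥0∞) {Q : Set X} (hQ : Q ∈ 𝒮) {x : X}
    (hx : x ∈ Q) : c Q ≤ familySup 𝒮 c x := by
  have : c Q = Q.indicator (fun _ => c Q) x := (Set.indicator_of_mem hx (fun _ => c Q)).symm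
  rw [this]
  exact le_iSup₂ (f := fun (Q : Set X) (_ : Q ∈ 𝒮) => Q.indicator (fun _ => c Q) x) Q hQ

lemma familySup_le {X : Type*} {𝒮 : Set (Set X)} {c : Set X → ℝ≥0∞} {x : X} {b : ℝ≥0∞}
    (h : ∀ Q ∈ 𝒮, x ∈ Q → c Q ≤ b) : familySup 𝒮 c x ≤ b := by
  refine iSup₂_le fun Q hQ => ?_
  by_cases hx : x ∈ Q
  · rw [Set.indicator_of_mem hx]; exact h Q hQ hx
  · rw [Set.indicator_of_notMem hx]; exact zero_le

section Nested

variable {X : Type*} [MeasurableSpace X] {𝒟 : Set (Set X)}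

lemma IsNestedFamily.pairwiseDisjoint (h : IsNestedFamily 𝒟) {T : Set (Set X)} (hT : T ⊆ 𝒟) :
    (maximals T).PairwiseDisjoint id := by
  intro Q hQ R hR hne
  rcases h.nested Q (hT hQ.prop) R (hT hR.prop) with h1 | h1 | h1
  · exact absurd (hQ.eq_of_le hR.prop h1) hne
  · exact absurd (hR.eq_of_le hQ.prop h1).symm hne
  · exact h1

lemma IsNestedFamily.sUnion_maximals (h : IsNestedFamily 𝒟) {T : Set (Set X)} (hT : T ⊆ 𝒟) :
    ⋃ R ∈ maximals T, R = ⋃₀ T := by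
  refine Set.Subset.antisymm ?_ ?_
  · exact Set.iUnion₂_subset fun R hR => Set.subset_sUnion_of_mem hR.prop
  · refine Set.sUnion_subset fun Q hQ => ?_
    obtain ⟨R, hQR, hR⟩ := h.exists_maximal T hT Q hQ
    exact hQR.trans (Set.subset_biUnion_of_mem (u := fun R : Set X => R) hR)

lemma IsNestedFamily.countable_maximals (h : IsNestedFamily 𝒟) {T : Set (Set X)} (hT : T ⊆ 𝒟) :
    (maximals T).Countable :=
  h.countable.mono ((maximals_subset T).trans hT)

lemma IsNestedFamily.measure_sUnion (h : IsNestedFamily 𝒟) {T : Set (Set X)} (hT : T ⊆ 𝒟)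
    (ν : Measure X) : ν (⋃₀ T) = ∑' R : maximals T, ν R := by
  rw [← h.sUnion_maximals hT]
  exact measure_biUnion (h.countable_maximals hT) (h.pairwiseDisjoint hT)
    fun R hR => h.measurableSet R (hT hR.prop)

/-- The weak type estimate for the maximal function of a nested family. -/
lemma IsNestedFamily.mul_measure_sUnion_le (h : IsNestedFamily 𝒟) {T : Set (Set X)} (hT : T ⊆ 𝒟)
    (ν : Measure X) (c : ℝ≥0∞) (F : X → ℝ≥0∞) (hF : ∀ Q ∈ T, c * ν Q ≤ ∫⁻ x in Q, F x ∂ν) :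
    c * ν (⋃₀ T) ≤ ∫⁻ x, F x ∂ν := by
  rw [h.measure_sUnion hT, ← ENNReal.tsum_mul_left]
  calc ∑' R : maximals T, c * ν R ≤ ∑' R : maximals T, ∫⁻ x in (R : Set X), F x ∂ν :=
        ENNReal.tsum_le_tsum fun R => hF R R.2.prop
    _ = ∫⁻ x in ⋃ R ∈ maximals T, R, F x ∂ν :=
        (lintegral_biUnion (h.countable_maximals hT)
          (fun R hR => h.measurableSet R (hT hR.prop)) (h.pairwiseDisjoint hT) F).symm
    _ ≤ _ := setLIntegral_le_lintegral _ _

/-- The members of `𝒟` on which the `ν`-average of `g` exceeds `2 ^ k`. -/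
def levelFamily (𝒟 : Set (Set X)) (ν : Measure X) (g : X → ℝ≥0∞) (k : ℤ) : Set (Set X) :=
  {Q ∈ 𝒟 | 2 ^ k * ν Q < ∫⁻ x in Q, g x ∂ν}

/-- The strong type estimate for the maximal function of a nested family, for the discretized
`L ^ p` norm. On a set where the average of `g` exceeds `2 ^ (k + 1)`, the part of `g` above
`2 ^ k` has average at least `2 ^ k`, so the weak type estimate applies to that part. -/
lemma IsNestedFamily.tsum_levelFamily_le (h : IsNestedFamily 𝒟) {ν : Measure X}
    (hν : ∀ Q ∈ 𝒟, ν Q ≠ ∞) {g : X → ℝ≥0∞} (hg : Measurable g) {p : ℝ} (hp : 1 < p) :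
    ∑' k : ℤ, (2 ^ k) ^ p * ν (⋃₀ levelFamily 𝒟 ν g k) ≤ levelConst p * ∫⁻ x, g x ^ p ∂ν := by
  have hpow (k : ℤ) : (2 : ℝ≥0∞) ^ k ≠ 0 := (ENNReal.zpow_pos (by simp) (by simp) k).ne'
  have hpow' (k : ℤ) : (2 : ℝ≥0∞) ^ k ≠ ∞ := (ENNReal.zpow_lt_top (by simp) (by simp) k).ne
  have weak (k : ℤ) : 2 ^ k * ν (⋃₀ levelFamily 𝒟 ν g (k + 1)) ≤
      ∫⁻ x, {y : ℝ≥0∞ | 2 ^ k < y}.indicator id (g x) ∂ν := by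
    refine h.mul_measure_sUnion_le (fun Q hQ => hQ.1) ν _ _ fun Q hQ => ?_
    have hfin : 2 ^ k * ν Q ≠ ∞ := ENNReal.mul_ne_top (hpow' k) (hν Q hQ.1)
    refine (ENNReal.add_le_add_iff_left hfin).1 ?_
    calc 2 ^ k * ν Q + 2 ^ k * ν Q = 2 ^ (k + 1) * ν Q := by
          rw [ENNReal.zpow_add (by simp) (by simp), zpow_one]; ring
      _ ≤ ∫⁻ x in Q, g x ∂ν := hQ.2.le
      _ ≤ ∫⁻ x in Q, (2 ^ k + {y : ℝ≥0∞ | 2 ^ k < y}.indicator id (g x)) ∂ν := by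
          gcongr with x
          by_cases hx : 2 ^ k < g x
          · rw [Set.indicator_of_mem (by exact hx)]; exact le_add_self
          · exact (not_lt.1 hx).trans le_self_add
      _ = _ := by
          rw [lintegral_add_left measurable_const, setLIntegral_const]
  calc ∑' k : ℤ, (2 ^ k) ^ p * ν (⋃₀ levelFamily 𝒟 ν g k)
      = ∑' k : ℤ, (2 ^ (k + 1)) ^ p * ν (⋃₀ levelFamily 𝒟 ν g (k + 1)) :=
        ((Equiv.addRight (1 : ℤ)).tsum_eq
          (fun k : ℤ => (2 ^ k) ^ p * ν (⋃₀ levelFamily 𝒟 ν g k))).symm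
    _ ≤ ∑' k : ℤ, ∫⁻ x, (2 ^ (k + 1)) ^ p * (2 ^ k : ℝ≥0∞)⁻¹ *
          {y : ℝ≥0∞ | 2 ^ k < y}.indicator id (g x) ∂ν := by
        gcongr with k
        rw [lintegral_const_mul' _ _ (ENNReal.mul_ne_top
          (ENNReal.rpow_ne_top_of_nonneg (by linarith) (hpow' _)) (ENNReal.inv_ne_top.2 (hpow k))),
          mul_assoc]
        gcongr
        rw [← ENNReal.div_eq_inv_mul, ENNReal.le_div_iff_mul_le (.inl (hpow k)) (.inl (hpow' k)),
          mul_comm]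
        exact weak k
    _ = ∫⁻ x, ∑' k : ℤ, (2 ^ (k + 1)) ^ p * (2 ^ k : ℝ≥0∞)⁻¹ *
          {y : ℝ≥0∞ | 2 ^ k < y}.indicator id (g x) ∂ν := by
        refine (lintegral_tsum fun k => ?_).symm
        exact (((measurable_id.indicator measurableSet_Ioi).comp hg).const_mul _).aemeasurable
    _ ≤ ∫⁻ x, levelConst p * g x ^ p ∂ν := by
        gcongr with x
        exact tsum_zpow_lt_le hp (g x)
    _ = _ := lintegral_const_mul' _ _ (levelConst_ne_top hp)

/-! ### The two-weight estimate for a nested family -/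

lemma measurable_familySup {𝒮 : Set (Set X)} (h𝒮 : 𝒮.Countable)
    (hm : ∀ Q ∈ 𝒮, MeasurableSet Q) (c : Set X → ℝ≥0∞) : Measurable (familySup 𝒮 c) :=
  Measurable.biSup 𝒮 h𝒮 fun Q hQ => measurable_const.indicator (hm Q hQ)

/-- The constant in the dyadic two-weight estimate. -/
noncomputable def dyadicConst {m : ℕ} (P : Fin m → ℝ) (q : ℝ) : ℝ≥0∞ :=
  ∏ i, 2 ^ q * levelConst (P i) ^ (q / P i)

/-- The members of `𝒟` on which, for every `i`, the `σ i`-average of `g i` lies in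
`(2 ^ k i, 2 ^ (k i + 1)]`. -/
def boxFamily {m : ℕ} (𝒟 : Set (Set X)) (σ : Fin m → Measure X) (g : Fin m → X → ℝ≥0∞)
    (k : Fin m → ℤ) : Set (Set X) :=
  {Q ∈ 𝒟 | ∀ i, 2 ^ k i * σ i Q < ∫⁻ x in Q, g i x ∂σ i ∧
    ∫⁻ x in Q, g i x ∂σ i ≤ 2 ^ (k i + 1) * σ i Q}

/-- The maximal function is controlled by the maximal functions of the weights, localized to the
maximal members of the families on which all the averages are essentially constant. -/
lemma familySup_rpow_le {m : ℕ} (h : IsNestedFamily 𝒟) {q : ℝ} (hq : 0 < q)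
    (σ : Fin m → Measure X) (hσ0 : ∀ i, ∀ Q ∈ 𝒟, σ i Q ≠ 0) (hσ : ∀ i, ∀ Q ∈ 𝒟, σ i Q ≠ ∞)
    (g : Fin m → X → ℝ≥0∞) (hg : ∀ i, ∀ Q ∈ 𝒟, ∫⁻ x in Q, g i x ∂σ i ≠ ∞)
    (ρ : Set X → ℝ≥0∞) (x : X) :
    familySup 𝒟 (fun Q => ρ Q * ∏ i, ∫⁻ y in Q, g i y ∂σ i) x ^ q ≤
      ∑' k : Fin m → ℤ, (∏ i, (2 ^ (k i + 1) : ℝ≥0∞)) ^ q * ∑' R : maximals (boxFamily 𝒟 σ g k),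
        (R : Set X).indicator (fun x => familySup {Q ∈ 𝒟 | Q ⊆ R}
          (fun Q => ρ Q * ∏ i, σ i Q) x ^ q) x := by
  rw [← ENNReal.le_rpow_inv_iff hq]
  refine familySup_le fun Q hQ hx => ?_
  rw [ENNReal.le_rpow_inv_iff hq]
  by_cases h0 : ∃ i, ∫⁻ y in Q, g i y ∂σ i = 0
  · obtain ⟨i, hi⟩ := h0
    rw [Finset.prod_eq_zero (Finset.mem_univ i) hi, mul_zero, ENNReal.zero_rpow_of_pos hq]
    exact zero_le
  push Not at h0
  have hk (i : Fin m) : ∃ k : ℤ, 2 ^ k * σ i Q < ∫⁻ x in Q, g i x ∂σ i ∧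
      ∫⁻ x in Q, g i x ∂σ i ≤ 2 ^ (k + 1) * σ i Q := by
    obtain ⟨k, hk1, hk2⟩ := ENNReal.exists_mem_Ioc_zpow (y := 2)
      (ENNReal.div_ne_zero.2 ⟨h0 i, hσ i Q hQ⟩) (ENNReal.div_ne_top (hg i Q hQ) (hσ0 i Q hQ))
      (by norm_num) (by simp)
    refine ⟨k, ?_, ?_⟩
    · exact (ENNReal.lt_div_iff_mul_lt (.inl (hσ0 i Q hQ)) (.inl (hσ i Q hQ))).1 hk1
    · exact (ENNReal.div_le_iff (hσ0 i Q hQ) (hσ i Q hQ)).1 hk2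
  choose k hk using hk
  obtain ⟨R, hQR, hR⟩ := h.exists_maximal (boxFamily 𝒟 σ g k) (fun Q hQ => hQ.1) Q ⟨hQ, hk⟩
  calc (ρ Q * ∏ i, ∫⁻ y in Q, g i y ∂σ i) ^ q
      ≤ (ρ Q * ∏ i, (2 ^ (k i + 1) * σ i Q)) ^ q := by
        gcongr with i
        exact (hk i).2
    _ = (∏ i, (2 ^ (k i + 1) : ℝ≥0∞)) ^ q * (ρ Q * ∏ i, σ i Q) ^ q := by
        rw [← ENNReal.mul_rpow_of_nonneg _ _ hq.le, Finset.prod_mul_distrib]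
        congr 1; ring
    _ ≤ (∏ i, (2 ^ (k i + 1) : ℝ≥0∞)) ^ q * R.indicator (fun x => familySup {Q ∈ 𝒟 | Q ⊆ R}
          (fun Q => ρ Q * ∏ i, σ i Q) x ^ q) x := by
        rw [Set.indicator_of_mem (hQR hx)]
        gcongr
        exact le_familySup (𝒮 := {Q ∈ 𝒟 | Q ⊆ R}) (fun Q => ρ Q * ∏ i, σ i Q) ⟨hQ, hQR⟩ hx
    _ ≤ _ := by
        refine le_trans ?_ (ENNReal.le_tsum k)
        gcongr
        exact ENNReal.le_tsum (f := fun R : maximals (boxFamily 𝒟 σ g k) =>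
          (R : Set X).indicator (fun x => familySup {Q ∈ 𝒟 | Q ⊆ R}
          (fun Q => ρ Q * ∏ i, σ i Q) x ^ q) x) ⟨R, hR⟩

/-- Sawyer's theorem for a nested family: the testing condition implies the norm inequality.
The function `g i` is integrated against `σ i`, and `ρ Q` plays the role of the power of `|Q|`. -/
theorem lintegral_familySup_le {m : ℕ} [NeZero m] (h : IsNestedFamily 𝒟) (P : Fin m → ℝ) {q : ℝ}
    (hP : ∀ i, 1 < P i) (hqP : ∀ i, P i ≤ q) (μ : Measure X)
    (σ : Fin m → Measure X) (hσ0 : ∀ i, ∀ Q ∈ 𝒟, σ i Q ≠ 0) (hσ : ∀ i, ∀ Q ∈ 𝒟, σ i Q ≠ ∞)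
    (g : Fin m → X → ℝ≥0∞) (hgm : ∀ i, Measurable (g i))
    (hg : ∀ i, ∀ Q ∈ 𝒟, ∫⁻ x in Q, g i x ∂σ i ≠ ∞) (ρ : Set X → ℝ≥0∞) (B : ℝ≥0∞)
    (test : ∀ R ∈ 𝒟, ∫⁻ x in R, familySup {Q ∈ 𝒟 | Q ⊆ R} (fun Q => ρ Q * ∏ i, σ i Q) x ^ q ∂μ ≤
      B * ∏ i, σ i R ^ (q / P i)) :
    ∫⁻ x, familySup 𝒟 (fun Q => ρ Q * ∏ i, ∫⁻ y in Q, g i y ∂σ i) x ^ q ∂μ ≤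
      dyadicConst P q * B * ∏ i, (∫⁻ x, g i x ^ P i ∂σ i) ^ (q / P i) := by
  have hP0 (i : Fin m) : 0 < P i := zero_lt_one.trans (hP i)
  have hq : 0 < q := (hP0 0).trans_le (hqP 0)
  have hs (i : Fin m) : 1 ≤ q / P i := (one_le_div (hP0 i)).2 (hqP i)
  have hbox (k : Fin m → ℤ) : boxFamily 𝒟 σ g k ⊆ 𝒟 := fun Q hQ => hQ.1
  have hmeas (k : Fin m → ℤ) (R : maximals (boxFamily 𝒟 σ g k)) : MeasurableSet (R : Set X) :=
    h.measurableSet R (hbox k R.2.prop)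
  have hsup (R : Set X) : Measurable fun x => familySup {Q ∈ 𝒟 | Q ⊆ R}
      (fun Q => ρ Q * ∏ i, σ i Q) x ^ q :=
    (measurable_familySup (h.countable.mono fun Q hQ => hQ.1)
      (fun Q hQ => h.measurableSet Q hQ.1) _).pow_const q
  have hcount (k : Fin m → ℤ) : Countable (maximals (boxFamily 𝒟 σ g k)) :=
    (h.countable_maximals (hbox k)).to_subtype
  have inner (k : Fin m → ℤ) : ∑' R : maximals (boxFamily 𝒟 σ g k),
      ∫⁻ x in (R : Set X), familySup {Q ∈ 𝒟 | Q ⊆ R} (fun Q => ρ Q * ∏ i, σ i Q) x ^ q ∂μ ≤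
        B * ∏ i, σ i (⋃₀ levelFamily 𝒟 (σ i) (g i) (k i)) ^ (q / P i) := by
    calc _ ≤ ∑' R : maximals (boxFamily 𝒟 σ g k), B * ∏ i, σ i R ^ (q / P i) :=
          ENNReal.tsum_le_tsum fun R => test R (hbox k R.2.prop)
      _ ≤ B * ∏ i, (∑' R : maximals (boxFamily 𝒟 σ g k), σ i R) ^ (q / P i) := by
          rw [ENNReal.tsum_mul_left]
          gcongr
          exact tsum_prod_rpow_le (fun i (R : maximals (boxFamily 𝒟 σ g k)) => σ i R) hs
      _ ≤ _ := by
          gcongr with i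
          · linarith [hs i]
          · rw [← h.measure_sUnion (hbox k)]
            gcongr
            exact fun Q hQ => ⟨hQ.1, (hQ.2 i).1⟩
  calc ∫⁻ x, familySup 𝒟 (fun Q => ρ Q * ∏ i, ∫⁻ y in Q, g i y ∂σ i) x ^ q ∂μ
      ≤ ∫⁻ x, ∑' k : Fin m → ℤ, (∏ i, (2 ^ (k i + 1) : ℝ≥0∞)) ^ q *
          ∑' R : maximals (boxFamily 𝒟 σ g k), (R : Set X).indicator (fun x =>
            familySup {Q ∈ 𝒟 | Q ⊆ R} (fun Q => ρ Q * ∏ i, σ i Q) x ^ q) x ∂μ := by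
        gcongr with x
        exact familySup_rpow_le h hq σ hσ0 hσ g hg ρ x
    _ = ∑' k : Fin m → ℤ, (∏ i, (2 ^ (k i + 1) : ℝ≥0∞)) ^ q *
          ∑' R : maximals (boxFamily 𝒟 σ g k), ∫⁻ x in (R : Set X),
            familySup {Q ∈ 𝒟 | Q ⊆ R} (fun Q => ρ Q * ∏ i, σ i Q) x ^ q ∂μ := by
        have hm (k : Fin m → ℤ) (R : maximals (boxFamily 𝒟 σ g k)) :
            Measurable ((R : Set X).indicator (fun x =>
              familySup {Q ∈ 𝒟 | Q ⊆ R} (fun Q => ρ Q * ∏ i, σ i Q) x ^ q)) :=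
          (hsup R).indicator (hmeas k R)
        have hm' (k : Fin m → ℤ) : Measurable fun x =>
            ∑' R : maximals (boxFamily 𝒟 σ g k), (R : Set X).indicator (fun x =>
              familySup {Q ∈ 𝒟 | Q ⊆ R} (fun Q => ρ Q * ∏ i, σ i Q) x ^ q) x :=
          Measurable.tsum (hm k)
        rw [lintegral_tsum fun k => ((hm' k).const_mul _).aemeasurable]
        congr 1 with k
        rw [lintegral_const_mul _ (hm' k), lintegral_tsum fun R => (hm k R).aemeasurable]
        congr 2 with R
        exact lintegral_indicator (hmeas k R) _
    _ ≤ ∑' k : Fin m → ℤ, (∏ i, (2 ^ (k i + 1) : ℝ≥0∞)) ^ q *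
          (B * ∏ i, σ i (⋃₀ levelFamily 𝒟 (σ i) (g i) (k i)) ^ (q / P i)) := by
        gcongr with k
        exact inner k
    _ = ∑' k : Fin m → ℤ, B * ∏ i, (2 ^ q * ((2 ^ k i) ^ P i *
          σ i (⋃₀ levelFamily 𝒟 (σ i) (g i) (k i))) ^ (q / P i)) := by
        congr 1 with k
        rw [mul_left_comm, ← ENNReal.prod_rpow_of_nonneg hq.le, ← Finset.prod_mul_distrib]
        congr 2 with i
        rw [ENNReal.mul_rpow_of_nonneg _ _ (by linarith [hs i]), ← ENNReal.rpow_mul,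
          mul_div_cancel₀ _ (hP0 i).ne', ENNReal.zpow_add (by simp) (by simp), zpow_one,
          ENNReal.mul_rpow_of_nonneg _ _ hq.le]
        ring
    _ ≤ B * ∏ i, ∑' j : ℤ, (2 ^ q * ((2 ^ j) ^ P i *
          σ i (⋃₀ levelFamily 𝒟 (σ i) (g i) j)) ^ (q / P i)) := by
        rw [ENNReal.tsum_mul_left]
        gcongr
        exact tsum_pi_prod_le (fun i (j : ℤ) => (2 ^ q * ((2 ^ j) ^ P i *
          σ i (⋃₀ levelFamily 𝒟 (σ i) (g i) j)) ^ (q / P i)))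
    _ ≤ B * ∏ i, (2 ^ q * (levelConst (P i) * ∫⁻ x, g i x ^ P i ∂σ i) ^ (q / P i)) := by
        gcongr with i
        rw [ENNReal.tsum_mul_left]
        gcongr
        refine (tsum_rpow_le_rpow_tsum _ (hs i)).trans ?_
        gcongr
        · linarith [hs i]
        · exact h.tsum_levelFamily_le (hσ i) (hgm i) (hP i)
    _ = _ := by
        rw [dyadicConst, mul_comm _ B, mul_assoc, ← Finset.prod_mul_distrib]
        congr 2 with i
        rw [ENNReal.mul_rpow_of_nonneg _ _ (by linarith [hs i]), mul_assoc]

end Nested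

/-! ### Dyadic cubes -/

/-- The half-open cube of side length `2 ^ k` with index `j` in the dyadic grid with origin `s`,
described by the integer parts of the rescaled coordinates of its points. -/
def dyadicCube {n : ℕ} (s : Fin n → ℝ) (k : ℤ) (j : Fin n → ℤ) : Set (Fin n → ℝ) :=
  {x | ∀ i, ⌊(x i - s i) / 2 ^ k⌋ = j i}

/-- The dyadic cubes with origin `s` and side length at most `2 ^ N`. -/
def dyadicFamily {n : ℕ} (s : Fin n → ℝ) (N : ℤ) : Set (Set (Fin n → ℝ)) :=
  {Q | ∃ k ≤ N, ∃ j, Q = dyadicCube s k j}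

lemma dyadicCube_eq_pi {n : ℕ} (s : Fin n → ℝ) (k : ℤ) (j : Fin n → ℤ) :
    dyadicCube s k j =
      Set.univ.pi fun i => Set.Ico (s i + 2 ^ k * j i) (s i + 2 ^ k * j i + 2 ^ k) := by
  ext x
  have h2 : (0 : ℝ) < 2 ^ k := by positivity
  simp only [dyadicCube, Set.mem_ofPred_eq, Set.mem_univ_pi, Set.mem_Ico, Int.floor_eq_iff,
    le_div_iff₀ h2, div_lt_iff₀ h2]
  refine forall_congr' fun i => and_congr ?_ ?_ <;> constructor <;> intro h <;> linarith

lemma dyadicCube_nonempty {n : ℕ} (s : Fin n → ℝ) (k : ℤ) (j : Fin n → ℤ) :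
    (dyadicCube s k j).Nonempty := by
  refine ⟨fun i => s i + 2 ^ k * j i, fun i => ?_⟩
  have h2 : (0 : ℝ) < 2 ^ k := by positivity
  rw [add_sub_cancel_left, mul_div_cancel_left₀ _ h2.ne', Int.floor_intCast]

lemma floor_div_zpow_eq {k k' : ℤ} (hk : k ≤ k') (y : ℝ) :
    ⌊y / 2 ^ k'⌋ = ⌊y / 2 ^ k⌋ / 2 ^ (k' - k).toNat := by
  obtain ⟨d, rfl⟩ := Int.le.dest hk
  have : y / 2 ^ (k + (d : ℤ)) = y / 2 ^ k / ((2 ^ d : ℕ) : ℝ) := by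
    rw [zpow_add₀ (by norm_num), zpow_natCast, div_div]; push_cast; rfl
  rw [this, Int.floor_div_natCast]
  simp

lemma dyadicCube_subset {n : ℕ} {s : Fin n → ℝ} {k k' : ℤ} (hk : k ≤ k') {j j' : Fin n → ℤ}
    (h : ¬ Disjoint (dyadicCube s k j) (dyadicCube s k' j')) :
    dyadicCube s k j ⊆ dyadicCube s k' j' := by
  obtain ⟨y, hy, hy'⟩ := Set.not_disjoint_iff.1 h
  intro x hx i
  rw [← hy' i, floor_div_zpow_eq hk, floor_div_zpow_eq hk, hx i, hy i]

lemma isNestedFamily_dyadicFamily {n : ℕ} (s : Fin n → ℝ) (N : ℤ) :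
    IsNestedFamily (dyadicFamily s N) where
  countable := by
    refine (Set.countable_range fun kj : ℤ × (Fin n → ℤ) => dyadicCube s kj.1 kj.2).mono ?_
    rintro _ ⟨k, -, j, rfl⟩
    exact ⟨(k, j), rfl⟩
  measurableSet := by
    rintro _ ⟨k, -, j, rfl⟩
    rw [dyadicCube_eq_pi]
    exact MeasurableSet.univ_pi fun i => measurableSet_Ico
  nested := by
    rintro _ ⟨k, -, j, rfl⟩ _ ⟨k', -, j', rfl⟩
    by_cases h : Disjoint (dyadicCube s k j) (dyadicCube s k' j')
    · exact .inr (.inr h)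
    rcases le_total k k' with hk | hk
    · exact .inl (dyadicCube_subset hk h)
    · exact .inr (.inl (dyadicCube_subset hk fun h' => h h'.symm))
  exists_maximal := by
    intro T hT Q hQ
    -- A member of `T` of the largest possible scale among those containing `Q` is maximal.
    obtain ⟨k₀, -, j₀, rfl⟩ := id (hT hQ)
    obtain ⟨k, ⟨⟨hkN, j, hjT, hQj⟩, hmax⟩⟩ := Int.exists_greatest_of_bdd
      (P := fun k => k ≤ N ∧ ∃ j, dyadicCube s k j ∈ T ∧ dyadicCube s k₀ j₀ ⊆ dyadicCube s k j)
      ⟨N, fun z hz => hz.1⟩ (by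
        obtain ⟨k, hk, j, e⟩ := hT hQ
        exact ⟨k, hk, j, e ▸ hQ, e.subset⟩)
    refine ⟨dyadicCube s k j, hQj, hjT, fun R hR hle => ?_⟩
    obtain ⟨k', hk', j', rfl⟩ := hT hR
    refine dyadicCube_subset (hmax k' ⟨hk', j', hR, hQj.trans hle⟩) fun hd => ?_
    obtain ⟨x, hx⟩ := dyadicCube_nonempty s k j
    exact Set.disjoint_left.1 hd (hle hx) hx

lemma exists_isCube_ae_eq {n : ℕ} {s : Fin n → ℝ} {N : ℤ} {Q : Set (Fin n → ℝ)}
    (hQ : Q ∈ dyadicFamily s N) : ∃ R, IsCube R ∧ Q ⊆ R ∧ Q =ᵐ[volume] R := by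
  obtain ⟨k, -, j, rfl⟩ := hQ
  refine ⟨_, ⟨fun i => s i + 2 ^ k * j i, 2 ^ k, by positivity, rfl⟩, ?_, ?_⟩
  · rw [dyadicCube_eq_pi, ← Set.pi_univ_Icc]
    exact Set.pi_mono fun i _ => Set.Ico_subset_Icc_self
  · rw [dyadicCube_eq_pi]
    exact Measure.univ_pi_Ico_ae_eq_Icc (μ := fun _ => volume)

lemma volume_Icc_add {n : ℕ} (a : Fin n → ℝ) (l : ℝ) :
    volume (Set.Icc a fun i => a i + l) = ENNReal.ofReal l ^ n := by
  simp [Real.volume_Icc_pi]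

lemma IsCube.volume_ne_zero {n : ℕ} {Q : Set (Fin n → ℝ)} (hQ : IsCube Q) : volume Q ≠ 0 := by
  obtain ⟨a, l, hl, rfl⟩ := hQ
  rw [volume_Icc_add]
  exact pow_ne_zero _ (ENNReal.ofReal_pos.2 hl).ne'

lemma IsCube.volume_ne_top {n : ℕ} {Q : Set (Fin n → ℝ)} (hQ : IsCube Q) : volume Q ≠ ∞ := by
  obtain ⟨a, l, hl, rfl⟩ := hQ
  rw [volume_Icc_add]
  exact ENNReal.pow_ne_top ENNReal.ofReal_ne_top

lemma IsCube.measurableSet {n : ℕ} {Q : Set (Fin n → ℝ)} (hQ : IsCube Q) : MeasurableSet Q := by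
  obtain ⟨a, l, hl, rfl⟩ := hQ
  exact measurableSet_Icc

/-! ### Covering cubes by dyadic cubes of finitely many grids -/

/-- The origins of the `2 ^ n` grids: each coordinate is `0` or `2 ^ N / 3`. For all scales
`k ≤ N`, the distance of `2 ^ N / 3` to the multiples of `2 ^ k` is at least `2 ^ k / 3`. -/
noncomputable def gridOrigin {n : ℕ} (N : ℤ) (t : Fin n → Bool) (i : Fin n) : ℝ :=
  if t i then 2 ^ N / 3 else 0

/-- If the floors differ for both grids, then there are endpoints of each of the two grids at a
distance less than `2 ^ k / 3`, and so `3` divides a power of `2`. -/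
lemma exists_floor_eq {N k : ℤ} (hk : k ≤ N) {a l : ℝ} (hl : 3 * l < 2 ^ k) :
    ∃ b : Bool, ∀ y ∈ Set.Icc a (a + l),
      ⌊(y - if b then 2 ^ N / 3 else 0) / 2 ^ k⌋ = ⌊(a - if b then 2 ^ N / 3 else 0) / 2 ^ k⌋ := by
  have h2 : (0 : ℝ) < 2 ^ k := by positivity
  -- A change of the floor yields an endpoint of the grid in `(a, a + l]`.
  have key (s : ℝ) (h : ¬ ∀ y ∈ Set.Icc a (a + l), ⌊(y - s) / 2 ^ k⌋ = ⌊(a - s) / 2 ^ k⌋) :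
      ∃ u : ℤ, a < s + 2 ^ k * u ∧ s + 2 ^ k * u ≤ a + l := by
    push Not at h
    obtain ⟨y, hy, hne⟩ := h
    have hle : ⌊(a - s) / 2 ^ k⌋ ≤ ⌊(y - s) / 2 ^ k⌋ := by
      gcongr; exact hy.1
    have hlt := lt_of_le_of_ne hle (Ne.symm hne)
    refine ⟨⌊(y - s) / 2 ^ k⌋, ?_, ?_⟩
    · have := Int.floor_lt.1 hlt
      rw [div_lt_iff₀ h2] at this
      linarith
    · have := Int.floor_le ((y - s) / 2 ^ k)
      rw [le_div_iff₀ h2] at this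
      linarith [hy.2]
  by_contra! hcon
  obtain ⟨u, hu1, hu2⟩ := key 0 fun h => by
    obtain ⟨y, hy, hne⟩ := hcon false
    exact hne (by simpa using h y hy)
  obtain ⟨u', hu1', hu2'⟩ := key (2 ^ N / 3) fun h => by
    obtain ⟨y, hy, hne⟩ := hcon true
    exact hne (by simpa using h y hy)
  obtain ⟨d, rfl⟩ := Int.le.dest hk
  have e : (2 : ℝ) ^ (k + (d : ℤ)) = 2 ^ k * 2 ^ d := by
    rw [zpow_add₀ (by norm_num), zpow_natCast]
  rw [e] at hu1' hu2'
  have b1 : (2 : ℝ) ^ k * (2 ^ d + 3 * (u' - u)) < 2 ^ k * 1 := by linarith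
  have b2 : (2 : ℝ) ^ k * (-1) < 2 ^ k * (2 ^ d + 3 * (u' - u)) := by linarith
  have c1 := lt_of_mul_lt_mul_left b1 h2.le
  have c2 := lt_of_mul_lt_mul_left b2 h2.le
  have z1 : (2 : ℤ) ^ d + 3 * (u' - u) < 1 := by exact_mod_cast c1
  have z2 : -1 < (2 : ℤ) ^ d + 3 * (u' - u) := by exact_mod_cast c2
  have hdvd : (3 : ℤ) ∣ 2 ^ d := ⟨u - u', by linarith⟩
  have := Int.Prime.dvd_pow' (p := 3) (by norm_num) (by exact_mod_cast hdvd : ((3 : ℕ) : ℤ) ∣ 2 ^ d)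
  norm_num at this

lemma exists_dyadicCube_superset {n : ℕ} {N : ℤ} (a : Fin n → ℝ) {l : ℝ} (hl : 0 < l)
    (hlN : 6 * l ≤ 2 ^ N) : ∃ t : Fin n → Bool, ∃ Q ∈ dyadicFamily (gridOrigin N t) N,
      Set.Icc a (fun i => a i + l) ⊆ Q ∧
        volume Q ≤ 6 ^ n * volume (Set.Icc a fun i => a i + l) := by
  obtain ⟨k, hk1, hk2⟩ := exists_mem_Ico_zpow (x := 6 * l) (y := (2 : ℝ)) (by linarith)
    (by norm_num)
  have hkN : k ≤ N := (zpow_le_zpow_iff_right₀ (by norm_num : (1 : ℝ) < 2)).1 (hk1.trans hlN)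
  have h3 : 3 * l < 2 ^ k := by
    rw [zpow_add₀ (by norm_num), zpow_one] at hk2
    linarith
  choose t ht using fun i => exists_floor_eq hkN (a := a i) h3
  refine ⟨t, dyadicCube (gridOrigin N t) k fun i => ⌊(a i - gridOrigin N t i) / 2 ^ k⌋,
    ⟨k, hkN, _, rfl⟩, fun y hy i => ht i (y i) ⟨hy.1 i, hy.2 i⟩, ?_⟩
  rw [volume_Icc_add, dyadicCube_eq_pi, Real.volume_pi_Ico]
  simp only [add_sub_cancel_left, Finset.prod_const, Finset.card_univ, Fintype.card_fin]
  rw [← mul_pow]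
  gcongr
  calc ENNReal.ofReal (2 ^ k) ≤ ENNReal.ofReal (6 * l) := ENNReal.ofReal_le_ofReal hk1
    _ = 6 * ENNReal.ofReal l := by rw [ENNReal.ofReal_mul (by norm_num)]; norm_num

/-! ### The maximal function -/

/-- The normalizing factor `|Q| ^ (-m γ)` in the maximal function, where `γ = 1 - α / (m n)`. -/
noncomputable def cubeFactor {n : ℕ} (m : ℕ) (γ : ℝ) (Q : Set (Fin n → ℝ)) : ℝ≥0∞ :=
  (volume Q ^ γ)⁻¹ ^ m

lemma prod_div_eq {n m : ℕ} (γ : ℝ) (b : Fin m → ℝ≥0∞) (Q : Set (Fin n → ℝ)) :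
    ∏ i, b i / volume Q ^ γ = cubeFactor m γ Q * ∏ i, b i := by
  simp_rw [div_eq_mul_inv, Finset.prod_mul_distrib]
  rw [Finset.prod_const, Finset.card_univ, Fintype.card_fin, mul_comm, cubeFactor]

section Maximal

variable {n m : ℕ} {E : Type*} [ENorm E]

lemma le_fracMaximal (α : ℝ) (f : Fin m → (Fin n → ℝ) → E) {Q : Set (Fin n → ℝ)} (hQ : IsCube Q)
    {x : Fin n → ℝ} (hx : x ∈ Q) :
    cubeFactor m (1 - α / ((m : ℝ) * (n : ℝ))) Q * ∏ i, ∫⁻ y in Q, ‖f i y‖ₑ ≤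
      fracMaximal α f x := by
  rw [← prod_div_eq]
  exact le_iSup_of_le Q (le_iSup_of_le hQ (le_iSup_of_le hx le_rfl))

lemma fracMaximal_le {α : ℝ} {f : Fin m → (Fin n → ℝ) → E} {x : Fin n → ℝ} {b : ℝ≥0∞}
    (h : ∀ Q, IsCube Q → x ∈ Q →
      cubeFactor m (1 - α / ((m : ℝ) * (n : ℝ))) Q * ∏ i, ∫⁻ y in Q, ‖f i y‖ₑ ≤ b) :
    fracMaximal α f x ≤ b :=
  iSup_le fun Q => iSup_le fun hQ => iSup_le fun hx => by
    rw [prod_div_eq]; exact h Q hQ hx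

lemma lt_fracMaximal_iff {α : ℝ} {f : Fin m → (Fin n → ℝ) → E} {x : Fin n → ℝ} {b : ℝ≥0∞} :
    b < fracMaximal α f x ↔ ∃ Q, IsCube Q ∧ x ∈ Q ∧
      b < cubeFactor m (1 - α / ((m : ℝ) * (n : ℝ))) Q * ∏ i, ∫⁻ y in Q, ‖f i y‖ₑ := by
  simp only [fracMaximal, lt_iSup_iff, prod_div_eq, exists_prop]

/-- A cube may be replaced by a slightly larger one that contains it in its interior, so the
maximal function over closed cubes is lower semicontinuous. -/
lemma lowerSemicontinuous_fracMaximal (α : ℝ) (f : Fin m → (Fin n → ℝ) → E) :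
    LowerSemicontinuous (fracMaximal α f) := by
  intro x b hb
  obtain ⟨Q, hQ, hx, hbQ⟩ := lt_fracMaximal_iff.1 hb
  obtain ⟨a, l, hl, rfl⟩ := hQ
  set γ : ℝ := 1 - α / ((m : ℝ) * (n : ℝ)) with hγ
  set I := ∏ i, ∫⁻ y in Set.Icc a (fun j => a j + l), ‖f i y‖ₑ with hI
  have lim : Filter.Tendsto (fun ε : ℝ => ((ENNReal.ofReal (l + 2 * ε) ^ n) ^ γ)⁻¹ ^ m * I)
      (nhdsWithin 0 (Set.Ioi 0)) (nhds (((ENNReal.ofReal (l + 2 * 0) ^ n) ^ γ)⁻¹ ^ m * I)) := by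
    refine ENNReal.Tendsto.mul_const ?_ (.inl ?_)
    · have hc : Continuous fun ε : ℝ => ((ENNReal.ofReal (l + 2 * ε) ^ n) ^ γ)⁻¹ ^ m := by
        refine (ENNReal.continuous_pow m).comp (continuous_inv.comp
          (ENNReal.continuous_rpow_const.comp ((ENNReal.continuous_pow n).comp
          (ENNReal.continuous_ofReal.comp (by fun_prop)))))
      exact hc.continuousAt.tendsto.mono_left nhdsWithin_le_nhds
    · refine pow_ne_zero _ (ENNReal.inv_ne_zero.2 ?_)
      rw [mul_zero, add_zero]
      exact ENNReal.rpow_ne_top_of_ne_zero (pow_ne_zero _ (ENNReal.ofReal_pos.2 hl).ne')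
        (ENNReal.pow_ne_top ENNReal.ofReal_ne_top)
  rw [mul_zero, add_zero, ← volume_Icc_add a] at lim
  obtain ⟨ε, hε, hε0⟩ := ((lim.eventually_const_lt hbQ).and self_mem_nhdsWithin).exists
  have hcube : IsCube (Set.Icc (fun j => a j - ε) fun j => a j - ε + (l + 2 * ε)) :=
    ⟨fun j => a j - ε, l + 2 * ε, by linarith, rfl⟩
  have hnhds : Set.Icc (fun j => a j - ε) (fun j => a j - ε + (l + 2 * ε)) ∈ nhds x := by
    refine pi_Icc_mem_nhds (fun j => ?_) (fun j => ?_)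
    · linarith [hx.1 j]
    · linarith [hx.2 j]
  filter_upwards [hnhds] with y hy
  refine lt_fracMaximal_iff.2 ⟨_, hcube, hy, hε.trans_le ?_⟩
  rw [cubeFactor, volume_Icc_add]
  gcongr
  rw [hI]
  gcongr with i
  · intro j; simp only; linarith
  · intro j; simp only; linarith

lemma measurable_fracMaximal (α : ℝ) (f : Fin m → (Fin n → ℝ) → E) :
    Measurable (fracMaximal α f) :=
  (lowerSemicontinuous_fracMaximal α f).measurable

/-- The loss in the normalizing factor when a cube is replaced by a dyadic cube. -/
noncomputable def coveringConst (n m : ℕ) (γ : ℝ) : ℝ≥0∞ := ((6 ^ n) ^ γ) ^ m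

lemma coveringConst_ne_top (n m : ℕ) {γ : ℝ} (hγ : 0 ≤ γ) : coveringConst n m γ ≠ ∞ :=
  ENNReal.pow_ne_top (ENNReal.rpow_ne_top_of_nonneg hγ (ENNReal.pow_ne_top (by simp)))

lemma cubeFactor_le {γ : ℝ} (hγ : 0 ≤ γ) {Q R : Set (Fin n → ℝ)}
    (h : volume R ≤ 6 ^ n * volume Q) : cubeFactor m γ Q ≤ coveringConst n m γ * cubeFactor m γ R := by
  rw [cubeFactor, cubeFactor, coveringConst, ← mul_pow]
  gcongr
  have h6 : ((6 : ℝ≥0∞) ^ n) ^ γ ≠ 0 := (ENNReal.rpow_pos (by positivity) (by simp)).ne'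
  have h6' : ((6 : ℝ≥0∞) ^ n) ^ γ ≠ ∞ := ENNReal.rpow_ne_top_of_nonneg hγ (by simp)
  calc (volume Q ^ γ)⁻¹ = (6 ^ n) ^ γ * ((6 ^ n) ^ γ * volume Q ^ γ)⁻¹ := by
        rw [ENNReal.mul_inv (.inl h6) (.inl h6'), ← mul_assoc, ENNReal.mul_inv_cancel h6 h6',
          one_mul]
    _ ≤ _ := by
        gcongr
        rw [← ENNReal.mul_rpow_of_nonneg _ _ hγ]
        gcongr

/-- The maximal function is controlled by the dyadic maximal functions of the `2 ^ n` grids. -/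
lemma fracMaximal_rpow_le_liminf {α q : ℝ} (hγ : 0 ≤ 1 - α / ((m : ℝ) * (n : ℝ))) (hq : 0 < q)
    (f : Fin m → (Fin n → ℝ) → E) (x : Fin n → ℝ) :
    fracMaximal α f x ^ q ≤ Filter.liminf (fun N : ℕ =>
      coveringConst n m (1 - α / ((m : ℝ) * (n : ℝ))) ^ q *
        ∑ t : Fin n → Bool, familySup (dyadicFamily (gridOrigin N t) N)
          (fun Q => cubeFactor m (1 - α / ((m : ℝ) * (n : ℝ))) Q * ∏ i, ∫⁻ y in Q, ‖f i y‖ₑ) x ^ q)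
      Filter.atTop := by
  rw [← ENNReal.le_rpow_inv_iff hq]
  refine fracMaximal_le fun Q hQ hx => ?_
  rw [ENNReal.le_rpow_inv_iff hq]
  obtain ⟨a, l, hl, rfl⟩ := hQ
  have hN : ∀ᶠ N : ℕ in Filter.atTop, 6 * l ≤ (2 : ℝ) ^ N :=
    (tendsto_pow_atTop_atTop_of_one_lt (by norm_num)).eventually_ge_atTop _
  refine Filter.le_liminf_of_le (by isBoundedDefault) ?_
  filter_upwards [hN] with N hN
  obtain ⟨t, Q, hQ, hsub, hvol⟩ := exists_dyadicCube_superset (N := N) a hl (by exact_mod_cast hN)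
  set γ := 1 - α / ((m : ℝ) * (n : ℝ))
  calc _ ≤ (coveringConst n m γ * (cubeFactor m γ Q * ∏ i, ∫⁻ y in Q, ‖f i y‖ₑ)) ^ q := by
        rw [← mul_assoc]
        gcongr
        exact cubeFactor_le hγ hvol
    _ ≤ coveringConst n m γ ^ q * familySup (dyadicFamily (gridOrigin N t) N)
          (fun Q => cubeFactor m γ Q * ∏ i, ∫⁻ y in Q, ‖f i y‖ₑ) x ^ q := by
        rw [ENNReal.mul_rpow_of_nonneg _ _ hq.le]
        gcongr
        exact le_familySup (fun Q => cubeFactor m γ Q * ∏ i, ∫⁻ y in Q, ‖f i y‖ₑ) hQ (hsub hx)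
    _ ≤ _ := by
        gcongr
        exact Finset.single_le_sum (f := fun t => familySup (dyadicFamily (gridOrigin N t) N)
          (fun Q => cubeFactor m γ Q * ∏ i, ∫⁻ y in Q, ‖f i y‖ₑ) x ^ q)
          (fun _ _ => zero_le) (Finset.mem_univ t)

/-- Uniform bounds for all dyadic maximal functions give a bound for the maximal function. -/
lemma lintegral_fracMaximal_rpow_le {α q : ℝ} (hγ : 0 ≤ 1 - α / ((m : ℝ) * (n : ℝ))) (hq : 0 < q)
    (f : Fin m → (Fin n → ℝ) → E) (μ : Measure (Fin n → ℝ)) (D : ℝ≥0∞)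
    (h : ∀ s N, ∫⁻ x, familySup (dyadicFamily s N)
      (fun Q => cubeFactor m (1 - α / ((m : ℝ) * (n : ℝ))) Q * ∏ i, ∫⁻ y in Q, ‖f i y‖ₑ) x ^ q ∂μ
        ≤ D) :
    ∫⁻ x, fracMaximal α f x ^ q ∂μ ≤
      coveringConst n m (1 - α / ((m : ℝ) * (n : ℝ))) ^ q * (2 ^ n * D) := by
  set γ := 1 - α / ((m : ℝ) * (n : ℝ))
  have hm (N : ℕ) (t : Fin n → Bool) :
      Measurable fun x => familySup (dyadicFamily (gridOrigin N t) N)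
        (fun Q => cubeFactor m γ Q * ∏ i, ∫⁻ y in Q, ‖f i y‖ₑ) x ^ q := by
    have hD := isNestedFamily_dyadicFamily (gridOrigin (n := n) N t) N
    exact (measurable_familySup hD.countable hD.measurableSet _).pow_const q
  have hm' (N : ℕ) : Measurable fun x => ∑ t : Fin n → Bool,
      familySup (dyadicFamily (gridOrigin N t) N)
        (fun Q => cubeFactor m γ Q * ∏ i, ∫⁻ y in Q, ‖f i y‖ₑ) x ^ q :=
    Finset.measurable_fun_sum _ fun t _ => hm N t
  refine (lintegral_mono (fracMaximal_rpow_le_liminf hγ hq f)).trans ?_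
  refine (lintegral_liminf_le fun N => (hm' N).const_mul _).trans ?_
  refine Filter.liminf_le_of_frequently_le' (Filter.Frequently.of_forall fun N => ?_)
  rw [lintegral_const_mul _ (hm' N), lintegral_finsetSum _ fun t _ => hm N t]
  gcongr
  calc _ ≤ ∑ t : Fin n → Bool, D := Finset.sum_le_sum fun t _ => h _ _
    _ = 2 ^ n * D := by simp

end Maximal

/-! ### Weights and dual weights -/

lemma one_sub_conjExponent {p : ℝ} (hp : 1 < p) : 1 - p.conjExponent = -(p - 1)⁻¹ := by
  have : p - 1 ≠ 0 := by linarith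
  rw [Real.conjExponent]; field_simp; ring

section Weights

variable {n : ℕ}

lemma IsWeight.aemeasurable {w : (Fin n → ℝ) → ℝ} (hw : IsWeight w) :
    AEMeasurable (fun x => ENNReal.ofReal (w x)) volume :=
  hw.2.aestronglyMeasurable.aemeasurable.ennreal_ofReal

lemma IsWeight.aemeasurable_dualWeight {w : (Fin n → ℝ) → ℝ} (hw : IsWeight w) (p : ℝ) :
    AEMeasurable (dualWeight p w) volume :=
  hw.aemeasurable.pow_const _

lemma lintegral_weightMeasure {w : (Fin n → ℝ) → ℝ} (hw : IsWeight w) {F : (Fin n → ℝ) → ℝ≥0∞}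
    (hF : AEMeasurable F volume) :
    ∫⁻ x, F x ∂weightMeasure w = ∫⁻ x, F x * ENNReal.ofReal (w x) := by
  rw [weightMeasure, lintegral_withDensity_eq_lintegral_mul₀ hw.aemeasurable hF]
  simp_rw [Pi.mul_apply, mul_comm]

lemma setLIntegral_weightMeasure {w : (Fin n → ℝ) → ℝ} (hw : IsWeight w)
    {F : (Fin n → ℝ) → ℝ≥0∞} (hF : AEMeasurable F volume) {Q : Set (Fin n → ℝ)}
    (hQ : MeasurableSet Q) :
    ∫⁻ x in Q, F x ∂weightMeasure w = ∫⁻ x in Q, F x * ENNReal.ofReal (w x) := by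
  rw [weightMeasure, restrict_withDensity hQ,
    lintegral_withDensity_eq_lintegral_mul₀ hw.aemeasurable.restrict hF.restrict]
  simp_rw [Pi.mul_apply, mul_comm]

lemma dualWeight_ne_zero {p : ℝ} (hp : 1 < p) (w : (Fin n → ℝ) → ℝ) (x : Fin n → ℝ) :
    dualWeight p w x ≠ 0 := by
  rw [dualWeight, Ne, ENNReal.rpow_eq_zero_iff, one_sub_conjExponent hp]
  have : 0 < (p - 1)⁻¹ := inv_pos.2 (by linarith)
  rintro (⟨-, h⟩ | ⟨h, -⟩)
  · linarith
  · exact ENNReal.ofReal_ne_top h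

lemma dualWeight_rpow {p : ℝ} (hp : 1 < p) {w : (Fin n → ℝ) → ℝ} {x : Fin n → ℝ} :
    dualWeight p w x ^ (1 - p) = ENNReal.ofReal (w x) := by
  have : p - 1 ≠ 0 := by linarith
  rw [dualWeight, ← ENNReal.rpow_mul, one_sub_conjExponent hp,
    show -(p - 1)⁻¹ * (1 - p) = 1 by field_simp; ring, ENNReal.rpow_one]

/-- The measure `σ dx` of the dual weight `σ`. -/
noncomputable def dualMeasure (p : ℝ) (w : (Fin n → ℝ) → ℝ) : Measure (Fin n → ℝ) :=
  volume.withDensity (dualWeight p w)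

lemma dualMeasure_apply (p : ℝ) (w : (Fin n → ℝ) → ℝ) {Q : Set (Fin n → ℝ)}
    (hQ : MeasurableSet Q) : dualMeasure p w Q = ∫⁻ x in Q, dualWeight p w x :=
  withDensity_apply _ hQ

lemma setLIntegral_dualWeight_ne_zero {p : ℝ} (hp : 1 < p) {w : (Fin n → ℝ) → ℝ}
    (hw : IsWeight w) {Q : Set (Fin n → ℝ)} (hQ : volume Q ≠ 0) :
    ∫⁻ x in Q, dualWeight p w x ≠ 0 := by
  intro h
  rw [lintegral_eq_zero_iff' (hw.aemeasurable_dualWeight p).restrict] at h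
  have : ∀ᵐ x ∂volume.restrict Q, False := by
    filter_upwards [h] with x hx using dualWeight_ne_zero hp w x hx
  rw [Filter.eventually_false_iff_eq_bot, ae_eq_bot, Measure.restrict_eq_zero] at this
  exact hQ this

/-- The cube `[-(N + 1), N + 1]ⁿ`. -/
def centeredCube (n N : ℕ) : Set (Fin n → ℝ) :=
  Set.Icc (fun _ => -((N : ℝ) + 1)) fun _ => -((N : ℝ) + 1) + 2 * ((N : ℝ) + 1)

lemma isCube_centeredCube (n N : ℕ) : IsCube (centeredCube n N) :=
  ⟨_, 2 * ((N : ℝ) + 1), by positivity, rfl⟩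

lemma exists_Icc_subset_centeredCube {a b : Fin n → ℝ} :
    ∃ N₀ : ℕ, ∀ N ≥ N₀, Set.Icc a b ⊆ centeredCube n N := by
  obtain ⟨N₀, hN₀⟩ := exists_nat_ge (‖a‖ + ‖b‖)
  refine ⟨N₀, fun N hN => ?_⟩
  have hN' : (N₀ : ℝ) ≤ N := by exact_mod_cast hN
  refine Set.Icc_subset_Icc (fun i => ?_) (fun i => ?_)
  · have h1 := (abs_le.1 ((Real.norm_eq_abs _).symm.le.trans (norm_le_pi_norm a i))).1
    have h2 := norm_nonneg b
    simp only; linarith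
  · have h1 := (abs_le.1 ((Real.norm_eq_abs _).symm.le.trans (norm_le_pi_norm b i))).2
    have h2 := norm_nonneg a
    simp only; linarith

lemma iUnion_centeredCube (n : ℕ) : ⋃ N, centeredCube n N = Set.univ := by
  refine Set.eq_univ_of_forall fun x => ?_
  obtain ⟨N, hN⟩ := exists_Icc_subset_centeredCube (a := x) (b := x)
  exact Set.mem_iUnion.2 ⟨N, hN N le_rfl (Set.mem_Icc.2 ⟨le_rfl, le_rfl⟩)⟩

lemma ae_dualWeight_ne_top {p : ℝ} {w : (Fin n → ℝ) → ℝ} (hw : IsWeight w)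
    (h : ∀ Q, IsCube Q → ∫⁻ x in Q, dualWeight p w x ≠ ∞) : ∀ᵐ x, dualWeight p w x ≠ ∞ := by
  rw [← Measure.restrict_univ (μ := (volume : Measure (Fin n → ℝ))), ← iUnion_centeredCube n,
    ae_restrict_iUnion_iff]
  intro N
  filter_upwards [ae_lt_top' (hw.aemeasurable_dualWeight p).restrict
    (h _ (isCube_centeredCube n N))] with x hx using hx.ne

/-- If `w > 0` almost everywhere, a function `f` on `ℝⁿ` has the form `f = g σ`, and then the norm
of `f` in `L ^ p (w)` is the norm of `g` in `L ^ p (σ)`. -/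
lemma exists_dual_function {p : ℝ} (hp : 1 < p) {w : (Fin n → ℝ) → ℝ} (hw : IsWeight w)
    (hfin : ∀ᵐ x, dualWeight p w x ≠ ∞) {F : (Fin n → ℝ) → ℝ≥0∞} (hF : AEMeasurable F volume) :
    ∃ g : (Fin n → ℝ) → ℝ≥0∞, Measurable g ∧
      (∀ Q, MeasurableSet Q → ∫⁻ x in Q, g x ∂dualMeasure p w = ∫⁻ x in Q, F x) ∧
      ∫⁻ x, g x ^ p ∂dualMeasure p w = ∫⁻ x, F x ^ p ∂weightMeasure w := by
  have hσ := hw.aemeasurable_dualWeight p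
  have hG : AEMeasurable (fun x => F x * (dualWeight p w x)⁻¹) volume := hF.mul hσ.inv
  have hgm : Measurable (hG.mk _) := hG.measurable_mk
  refine ⟨hG.mk _, hgm, fun Q hQ => ?_, ?_⟩
  · rw [dualMeasure, restrict_withDensity hQ, lintegral_withDensity_eq_lintegral_mul₀
      hσ.restrict hgm.aemeasurable]
    refine lintegral_congr_ae (ae_restrict_of_ae ?_)
    filter_upwards [hG.ae_eq_mk, hfin] with x hx hx'
    rw [Pi.mul_apply, ← hx, mul_left_comm,
      ENNReal.mul_inv_cancel (dualWeight_ne_zero hp w x) hx', mul_one]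
  · rw [lintegral_weightMeasure hw (hF.pow_const p), dualMeasure,
      lintegral_withDensity_eq_lintegral_mul₀ hσ (hgm.pow_const p).aemeasurable]
    refine lintegral_congr_ae ?_
    filter_upwards [hG.ae_eq_mk, hfin] with x hx hx'
    have h0 := dualWeight_ne_zero hp w x
    rw [Pi.mul_apply, ← hx, ENNReal.mul_rpow_of_nonneg _ _ (by linarith), mul_left_comm]
    congr 1
    rw [← dualWeight_rpow hp, ENNReal.inv_rpow, ← ENNReal.rpow_neg]
    nth_rewrite 1 [← ENNReal.rpow_one (dualWeight p w x)]
    rw [← ENNReal.rpow_add _ _ h0 hx']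
    congr 1

lemma setLIntegral_ne_top_of_rpow {X : Type*} [MeasurableSpace X] {ν : Measure X} {g : X → ℝ≥0∞}
    {p : ℝ} (hp : 1 < p) {Q : Set X} (hQ : ν Q ≠ ∞) (hg : ∫⁻ x, g x ^ p ∂ν ≠ ∞) :
    ∫⁻ x in Q, g x ∂ν ≠ ∞ := by
  refine ne_top_of_le_ne_top (ENNReal.add_ne_top.2 ⟨hQ, hg⟩) ?_
  calc ∫⁻ x in Q, g x ∂ν ≤ ∫⁻ x in Q, (1 + g x ^ p) ∂ν := by
        gcongr with x
        rcases le_total (g x) 1 with h | h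
        · exact h.trans le_self_add
        · exact (ENNReal.le_rpow_self_of_one_le h hp.le).trans le_add_self
    _ = ν Q + ∫⁻ x in Q, g x ^ p ∂ν := by
        rw [lintegral_add_left measurable_const, setLIntegral_one]
    _ ≤ _ := by gcongr; exact Measure.restrict_le_self

lemma eLpNorm_weightMeasure {E : Type*} [ENorm E] {q : ℝ} (hq : 0 < q) (F : (Fin n → ℝ) → E)
    (w : (Fin n → ℝ) → ℝ) :
    eLpNorm F (ENNReal.ofReal q) (weightMeasure w) =
      (∫⁻ x, ‖F x‖ₑ ^ q ∂weightMeasure w) ^ (1 / q) := by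
  rw [eLpNorm_eq_lintegral_rpow_enorm_toReal (ENNReal.ofReal_pos.2 hq).ne' ENNReal.ofReal_ne_top,
    ENNReal.toReal_ofReal hq.le]

end Weights

/-! ### The testing condition implies the norm inequality -/

section Sufficiency

variable {n m : ℕ} {α q : ℝ} {P : Fin m → ℝ} {w : Fin m → (Fin n → ℝ) → ℝ} {v : (Fin n → ℝ) → ℝ}

lemma testNum_eq (hv : IsWeight v) {Q : Set (Fin n → ℝ)} (hQ : IsCube Q) :
    testNum α P q w v Q = (∫⁻ x in Q, fracMaximal α
      (fun i => Q.indicator (dualWeight (P i) (w i))) x ^ q ∂weightMeasure v) ^ (1 / q) := by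
  rw [testNum, setLIntegral_weightMeasure hv
    ((measurable_fracMaximal _ _).pow_const q).aemeasurable hQ.measurableSet]

lemma ite_le_sawyerConst {Q : Set (Fin n → ℝ)} (hQ : IsCube Q)
    [Decidable (testNum α P q w v Q = ∞)] :
    (if testNum α P q w v Q = ∞ then ∞ else testNum α P q w v Q / testDen P w Q) ≤
      sawyerConst α P q w v := by
  refine le_trans (le_of_eq ?_) (le_iSup₂_of_le Q hQ le_rfl)
  congr

lemma testNum_ne_top (hA : sawyerConst α P q w v ≠ ∞) {Q : Set (Fin n → ℝ)} (hQ : IsCube Q) :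
    testNum α P q w v Q ≠ ∞ := by
  classical
  intro h
  have := ite_le_sawyerConst (α := α) (P := P) (q := q) (w := w) (v := v) hQ
  rw [if_pos h] at this
  exact hA (top_le_iff.1 this)

lemma setLIntegral_indicator_self {X : Type*} [MeasurableSpace X] {ν : Measure X} {Q : Set X}
    (hQ : MeasurableSet Q) (F : X → ℝ≥0∞) :
    ∫⁻ x in Q, ‖Q.indicator F x‖ₑ ∂ν = ∫⁻ x in Q, F x ∂ν :=
  setLIntegral_congr_fun hQ fun x hx => by
    simp only [Set.indicator_of_mem hx, enorm_eq_self]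

/-- If the testing constant is finite and `v` does not vanish almost everywhere, then the dual
weights are locally integrable: otherwise the numerator of the testing quotient would be infinite
on a large cube. -/
lemma setLIntegral_dualWeight_ne_top (hP : ∀ i, 1 < P i) (hq : 0 < q)
    (hγ : 0 ≤ 1 - α / ((m : ℝ) * (n : ℝ)))
    (hw : ∀ i, IsWeight (w i)) (hv : IsWeight v) (hA : sawyerConst α P q w v ≠ ∞)
    (hv0 : weightMeasure v ≠ 0) (i : Fin m) {Q : Set (Fin n → ℝ)} (hQ : IsCube Q) :
    ∫⁻ x in Q, dualWeight (P i) (w i) x ≠ ∞ := by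
  intro htop
  obtain ⟨N₀, hN₀⟩ : ∃ N, weightMeasure v (centeredCube n N) ≠ 0 := by
    by_contra! h
    refine hv0 (Measure.measure_univ_eq_zero.1 ?_)
    rw [← iUnion_centeredCube n]
    exact measure_iUnion_null h
  obtain ⟨a, l, hl, rfl⟩ := hQ
  obtain ⟨N₁, hN₁⟩ := exists_Icc_subset_centeredCube (a := a) (b := fun j => a j + l)
  obtain ⟨N₂, hN₂⟩ := exists_Icc_subset_centeredCube (n := n) (a := fun _ => -((N₀ : ℝ) + 1))
    (b := fun _ => -((N₀ : ℝ) + 1) + 2 * ((N₀ : ℝ) + 1))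
  obtain ⟨R, hR, hQR, hvR⟩ : ∃ R, IsCube R ∧ Set.Icc a (fun j => a j + l) ⊆ R ∧
      weightMeasure v R ≠ 0 := by
    refine ⟨_, isCube_centeredCube n (max N₁ N₂), hN₁ _ (le_max_left _ _), fun h0 => hN₀ ?_⟩
    exact measure_mono_null (hN₂ _ (le_max_right _ _)) h0
  have hM (x) (hx : x ∈ R) :
      fracMaximal α (fun i => R.indicator (dualWeight (P i) (w i))) x = ∞ := by
    refine top_le_iff.1 (le_trans (le_of_eq ?_) (le_fracMaximal α _ hR hx))
    simp_rw [setLIntegral_indicator_self hR.measurableSet]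
    have hi : ∫⁻ x in R, dualWeight (P i) (w i) x = ∞ :=
      top_le_iff.1 (htop.symm.le.trans (lintegral_mono_set hQR))
    rw [← Finset.mul_prod_erase _ _ (Finset.mem_univ i), hi, ENNReal.top_mul, ENNReal.mul_top]
    · refine pow_ne_zero _ (ENNReal.inv_ne_zero.2 ?_)
      exact ENNReal.rpow_ne_top_of_nonneg hγ hR.volume_ne_top
    · exact Finset.prod_ne_zero_iff.2 fun j _ =>
        setLIntegral_dualWeight_ne_zero (hP j) (hw j) hR.volume_ne_zero
  refine testNum_ne_top hA hR ?_
  rw [testNum_eq hv hR, setLIntegral_congr_fun hR.measurableSet (g := fun _ => ∞)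
    fun x hx => by simp only [hM x hx, ENNReal.top_rpow_of_pos hq], setLIntegral_const,
    ENNReal.top_mul hvR, ENNReal.top_rpow_of_pos (one_div_pos.2 hq)]

lemma testNum_le (hP : ∀ i, 1 < P i) (hw : ∀ i, IsWeight (w i))
    (hA : sawyerConst α P q w v ≠ ∞)
    (hσ : ∀ i Q, IsCube Q → ∫⁻ x in Q, dualWeight (P i) (w i) x ≠ ∞)
    {Q : Set (Fin n → ℝ)} (hQ : IsCube Q) :
    testNum α P q w v Q ≤ sawyerConst α P q w v * testDen P w Q := by
  classical
  have h := ite_le_sawyerConst (α := α) (P := P) (q := q) (w := w) (v := v) hQ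
  rw [if_neg (testNum_ne_top hA hQ)] at h
  refine (ENNReal.div_le_iff ?_ ?_).1 h
  · refine Finset.prod_ne_zero_iff.2 fun i _ => ?_
    refine (ENNReal.rpow_pos (pos_iff_ne_zero.2 ?_) (hσ i Q hQ)).ne'
    exact setLIntegral_dualWeight_ne_zero (hP i) (hw i) hQ.volume_ne_zero
  · refine ENNReal.prod_ne_top fun i _ => ENNReal.rpow_ne_top_of_nonneg ?_ (hσ i Q hQ)
    exact one_div_nonneg.2 (by linarith [hP i])

/-- The testing condition passes from closed cubes to dyadic cubes. -/
lemma setLIntegral_familySup_le (hP : ∀ i, 1 < P i) (hq : 0 < q) (hw : ∀ i, IsWeight (w i))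
    (hv : IsWeight v) (hA : sawyerConst α P q w v ≠ ∞)
    (hσ : ∀ i Q, IsCube Q → ∫⁻ x in Q, dualWeight (P i) (w i) x ≠ ∞)
    {s : Fin n → ℝ} {N : ℤ} {R : Set (Fin n → ℝ)} (hR : R ∈ dyadicFamily s N) :
    ∫⁻ x in R, familySup {Q ∈ dyadicFamily s N | Q ⊆ R}
        (fun Q => cubeFactor m (1 - α / ((m : ℝ) * (n : ℝ))) Q *
          ∏ i, dualMeasure (P i) (w i) Q) x ^ q ∂weightMeasure v ≤
      sawyerConst α P q w v ^ q * ∏ i, dualMeasure (P i) (w i) R ^ (q / P i) := by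
  have hD := isNestedFamily_dyadicFamily s N
  obtain ⟨R', hR', hRR', hae⟩ := exists_isCube_ae_eq hR
  have hsup (x) : familySup {Q ∈ dyadicFamily s N | Q ⊆ R}
        (fun Q => cubeFactor m (1 - α / ((m : ℝ) * (n : ℝ))) Q *
          ∏ i, dualMeasure (P i) (w i) Q) x ≤
      fracMaximal α (fun i => R'.indicator (dualWeight (P i) (w i))) x := by
    refine familySup_le fun Q ⟨hQ, hQR⟩ hx => ?_
    obtain ⟨Q', hQ', hQQ', haeQ⟩ := exists_isCube_ae_eq hQ
    refine le_trans ?_ (le_fracMaximal α _ hQ' (hQQ' hx))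
    rw [cubeFactor, cubeFactor, measure_congr haeQ]
    gcongr with i
    rw [dualMeasure_apply _ _ (hD.measurableSet Q hQ),
      ← setLIntegral_indicator_self (hD.measurableSet Q hQ)]
    calc ∫⁻ x in Q, ‖Q.indicator (dualWeight (P i) (w i)) x‖ₑ
        ≤ ∫⁻ x in Q, ‖R'.indicator (dualWeight (P i) (w i)) x‖ₑ := by
          simp only [enorm_eq_self]
          gcongr
          exact hQR.trans hRR'
      _ ≤ _ := lintegral_mono_set hQQ'
  calc _ ≤ ∫⁻ x in R', fracMaximal α (fun i => R'.indicator (dualWeight (P i) (w i))) x ^ q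
        ∂weightMeasure v := by
        refine (lintegral_mono_set hRR').trans ?_
        gcongr with x
        exact hsup x
    _ = testNum α P q w v R' ^ q := by
        rw [testNum_eq hv hR', ← ENNReal.rpow_mul, one_div_mul_cancel hq.ne', ENNReal.rpow_one]
    _ ≤ (sawyerConst α P q w v * testDen P w R') ^ q := by
        gcongr
        exact testNum_le hP hw hA hσ hR'
    _ = _ := by
        rw [ENNReal.mul_rpow_of_nonneg _ _ hq.le, testDen, ← ENNReal.prod_rpow_of_nonneg hq.le]
        congr 2 with i
        have hae' : R =ᵐ[dualMeasure (P i) (w i)] R' :=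
          (withDensity_absolutelyContinuous _ _).ae_eq hae
        rw [← ENNReal.rpow_mul, ← dualMeasure_apply _ _ hR'.measurableSet, measure_congr hae']
        congr 1
        ring

/-- The constant in the upper bound for the norm. -/
noncomputable def upperConst (n : ℕ) {m : ℕ} (α : ℝ) (P : Fin m → ℝ) (q : ℝ) : ℝ≥0∞ :=
  (coveringConst n m (1 - α / ((m : ℝ) * (n : ℝ))) ^ q * (2 ^ n * dyadicConst P q)) ^ (1 / q)

lemma dyadicConst_ne_top (hP : ∀ i, 1 < P i) (hq : 0 < q) : dyadicConst P q ≠ ∞ := by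
  refine ENNReal.prod_ne_top fun i _ => ENNReal.mul_ne_top
    (ENNReal.rpow_ne_top_of_nonneg hq.le (by simp))
    (ENNReal.rpow_ne_top_of_nonneg (div_nonneg hq.le (by linarith [hP i]))
      (levelConst_ne_top (hP i)))

lemma upperConst_ne_top (hP : ∀ i, 1 < P i) (hq : 0 < q)
    (hγ : 0 ≤ 1 - α / ((m : ℝ) * (n : ℝ))) : upperConst n α P q ≠ ∞ := by
  refine ENNReal.rpow_ne_top_of_nonneg (one_div_nonneg.2 hq.le) (ENNReal.mul_ne_top
    (ENNReal.rpow_ne_top_of_nonneg hq.le (coveringConst_ne_top n m hγ))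
    (ENNReal.mul_ne_top (by simp) (dyadicConst_ne_top hP hq)))

/-- The dyadic estimate is applied to `g i = f i / σ i` and to all the grids. -/
theorem hasNormBound_of_sawyerConst_ne_top [NeZero m] (hP : ∀ i, 1 < P i) (hqP : ∀ i, P i ≤ q)
    (hγ : 0 ≤ 1 - α / ((m : ℝ) * (n : ℝ))) (hw : ∀ i, IsWeight (w i)) (hv : IsWeight v)
    (hA : sawyerConst α P q w v ≠ ∞) :
    HasNormBound α P q w v (upperConst n α P q * sawyerConst α P q w v) := by
  have hP0 (i : Fin m) : 0 < P i := zero_lt_one.trans (hP i)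
  have hq : 0 < q := (hP0 0).trans_le (hqP 0)
  intro f hf
  rcases eq_or_ne (weightMeasure v) 0 with hv0 | hv0
  · rw [hv0, eLpNorm_measure_zero]
    exact zero_le
  have hσ (i Q) (hQ : IsCube Q) := setLIntegral_dualWeight_ne_top hP hq hγ hw hv hA hv0 i hQ
  choose g hgm hgf hgp using fun i => exists_dual_function (hP i) (hw i)
    (ae_dualWeight_ne_top (hw i) (hσ i)) (hf i).1.enorm
  have hfp (i) : ∫⁻ x, ‖f i x‖ₑ ^ P i ∂weightMeasure (w i) ≠ ∞ := by
    have h := (hf i).2.2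
    rw [eLpNorm_weightMeasure (hP0 i)] at h
    exact ((ENNReal.rpow_lt_top_iff_of_pos (one_div_pos.2 (hP0 i))).1 h).ne
  have hfam (s : Fin n → ℝ) (N : ℤ) : ∫⁻ x, familySup (dyadicFamily s N)
      (fun Q => cubeFactor m (1 - α / ((m : ℝ) * (n : ℝ))) Q * ∏ i, ∫⁻ y in Q, ‖f i y‖ₑ) x ^ q
        ∂weightMeasure v ≤ dyadicConst P q * sawyerConst α P q w v ^ q *
          ∏ i, (∫⁻ x, ‖f i x‖ₑ ^ P i ∂weightMeasure (w i)) ^ (q / P i) := by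
    have hD := isNestedFamily_dyadicFamily s N
    have hcube (i Q) (hQ : Q ∈ dyadicFamily s N) : ∃ R, IsCube R ∧
        dualMeasure (P i) (w i) Q = ∫⁻ x in R, dualWeight (P i) (w i) x := by
      obtain ⟨R, hR, -, hae⟩ := exists_isCube_ae_eq hQ
      refine ⟨R, hR, ?_⟩
      rw [dualMeasure_apply _ _ (hD.measurableSet Q hQ), Measure.restrict_congr_set hae]
    have hne (i Q) (hQ : Q ∈ dyadicFamily s N) : dualMeasure (P i) (w i) Q ≠ ∞ := by
      obtain ⟨R, hR, e⟩ := hcube i Q hQ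
      exact e ▸ hσ i R hR
    have key := lintegral_familySup_le hD P hP hqP (weightMeasure v)
      (fun i => dualMeasure (P i) (w i))
      (fun i Q hQ => by
        obtain ⟨R, hR, e⟩ := hcube i Q hQ
        exact e ▸ setLIntegral_dualWeight_ne_zero (hP i) (hw i) hR.volume_ne_zero)
      hne g hgm
      (fun i Q hQ => setLIntegral_ne_top_of_rpow (hP i) (hne i Q hQ) (hgp i ▸ hfp i))
      (cubeFactor m (1 - α / ((m : ℝ) * (n : ℝ)))) _
      (fun R hR => setLIntegral_familySup_le hP hq hw hv hA hσ hR)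
    simp_rw [hgp] at key
    refine le_trans ?_ key
    gcongr with x
    refine familySup_le fun Q hQ hx => ?_
    simp_rw [← hgf _ Q (hD.measurableSet Q hQ)]
    exact le_familySup (fun Q => cubeFactor m (1 - α / ((m : ℝ) * (n : ℝ))) Q *
      ∏ i, ∫⁻ y in Q, g i y ∂dualMeasure (P i) (w i)) hQ hx
  have hmain := lintegral_fracMaximal_rpow_le hγ hq f (weightMeasure v) _ hfam
  rw [eLpNorm_weightMeasure hq]
  simp_rw [enorm_eq_self, eLpNorm_weightMeasure (hP0 _)]
  have hq' : 0 ≤ 1 / q := one_div_nonneg.2 hq.le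
  refine (ENNReal.rpow_le_rpow hmain hq').trans (le_of_eq ?_)
  calc _ = ((coveringConst n m (1 - α / ((m : ℝ) * (n : ℝ))) ^ q * (2 ^ n * dyadicConst P q)) *
        sawyerConst α P q w v ^ q *
          ∏ i, (∫⁻ x, ‖f i x‖ₑ ^ P i ∂weightMeasure (w i)) ^ (q / P i)) ^ (1 / q) := by
        congr 1; ring
    _ = _ := by
        rw [ENNReal.mul_rpow_of_nonneg _ _ hq', ENNReal.mul_rpow_of_nonneg _ _ hq', ← upperConst,
          ← ENNReal.rpow_mul, mul_one_div_cancel hq.ne', ENNReal.rpow_one,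
          ← ENNReal.prod_rpow_of_nonneg hq']
        congr 2 with i
        rw [← ENNReal.rpow_mul]
        congr 1
        field_simp

end Sufficiency

/-! ### The norm inequality implies the testing condition -/

section Necessity

variable {n m : ℕ} {α q : ℝ} {P : Fin m → ℝ} {w : Fin m → (Fin n → ℝ) → ℝ} {v : (Fin n → ℝ) → ℝ}

/-- Since `σ ^ p w = σ`, any truncation `u` of the dual weight `σ` satisfies `u ^ p w ≤ u`, so its
norm in `L ^ p (w)` is controlled by its integral. -/
lemma rpow_mul_ofReal_le {p : ℝ} (hp : 1 < p) {w : (Fin n → ℝ) → ℝ} {x : Fin n → ℝ} {u : ℝ≥0∞}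
    (hu : u ≤ dualWeight p w x) (hut : u ≠ ∞) : u ^ p * ENNReal.ofReal (w x) ≤ u := by
  rcases eq_or_ne u 0 with rfl | h0
  · simp [ENNReal.zero_rpow_of_pos (zero_lt_one.trans hp)]
  calc u ^ p * ENNReal.ofReal (w x) ≤ u ^ p * u ^ (1 - p) := by
        rw [← dualWeight_rpow hp]
        gcongr u ^ p * ?_
        rw [← neg_sub p 1, ENNReal.rpow_neg, ENNReal.rpow_neg, ENNReal.inv_le_inv]
        exact ENNReal.rpow_le_rpow hu (by linarith)
    _ = u := by
        rw [← ENNReal.rpow_add _ _ h0 hut, add_sub_cancel, ENNReal.rpow_one]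

/-- The norm inequality for the functions `1_Q G i`, where `G i` is at most the dual weight. -/
lemma HasNormBound.setLIntegral_fracMaximal_le {C : ℝ≥0∞} (h : HasNormBound α P q w v C)
    (hP : ∀ i, 1 < P i) (hq : 0 < q) (hw : ∀ i, IsWeight (w i)) {Q : Set (Fin n → ℝ)}
    (hQ : IsCube Q) (G : Fin m → (Fin n → ℝ) → ℝ≥0∞) (hGm : ∀ i, AEMeasurable (G i) volume)
    (hG : ∀ i x, G i x ≤ dualWeight (P i) (w i) x) (hfin : ∀ i, ∫⁻ x in Q, G i x ≠ ∞) :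
    (∫⁻ x in Q, fracMaximal α (fun i => Q.indicator (G i)) x ^ q ∂weightMeasure v) ^ (1 / q) ≤
      C * ∏ i, (∫⁻ x in Q, G i x) ^ (1 / P i) := by
  have hP0 (i : Fin m) : 0 < P i := zero_lt_one.trans (hP i)
  have hm (i) : AEMeasurable (Q.indicator (G i)) volume := (hGm i).indicator hQ.measurableSet
  have hint (i) : ∫⁻ x, Q.indicator (G i) x = ∫⁻ x in Q, G i x :=
    lintegral_indicator hQ.measurableSet _
  have hae (i) : ∀ᵐ x, Q.indicator (G i) x ≠ ∞ := by
    filter_upwards [ae_lt_top' (hm i) (by rw [hint]; exact hfin i)] with x hx using hx.ne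
  set f : Fin m → (Fin n → ℝ) → ℝ := fun i x => (Q.indicator (G i) x).toReal with hf
  have hfae (i) : ∀ᵐ x, ‖f i x‖ₑ = Q.indicator (G i) x := by
    filter_upwards [hae i] with x hx using Real.enorm_toReal hx
  have hfm (i) : AEMeasurable (f i) volume := (hm i).ennreal_toReal
  have hnorm (i) : eLpNorm (f i) (ENNReal.ofReal (P i)) (weightMeasure (w i)) ≤
      (∫⁻ x in Q, G i x) ^ (1 / P i) := by
    rw [eLpNorm_weightMeasure (hP0 i), lintegral_weightMeasure (hw i) ((hfm i).enorm.pow_const _),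
      ← hint]
    refine ENNReal.rpow_le_rpow (lintegral_mono_ae ?_) (one_div_nonneg.2 (hP0 i).le)
    filter_upwards [hae i, hfae i] with x hx hx'
    rw [hx']
    exact rpow_mul_ofReal_le (hP i) ((Set.indicator_le_self Q (G i) x).trans (hG i x)) hx
  have hdom : MemDomain P w f := fun i => ⟨hfm i,
    (hfm i).aestronglyMeasurable.mono_ac (withDensity_absolutelyContinuous _ _),
    (hnorm i).trans_lt (ENNReal.rpow_lt_top_of_nonneg (one_div_nonneg.2 (hP0 i).le) (hfin i))⟩
  have hM (x) : fracMaximal α (fun i => Q.indicator (G i)) x = fracMaximal α f x := by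
    have (i) (R : Set (Fin n → ℝ)) :
        ∫⁻ y in R, ‖Q.indicator (G i) y‖ₑ = ∫⁻ y in R, ‖f i y‖ₑ :=
      lintegral_congr_ae (ae_restrict_of_ae ((hfae i).mono fun y hy => by
        simp only [hy, enorm_eq_self]))
    simp_rw [fracMaximal, this]
  calc _ ≤ eLpNorm (fracMaximal α f) (ENNReal.ofReal q) (weightMeasure v) := by
        rw [eLpNorm_weightMeasure hq]
        simp_rw [hM, enorm_eq_self]
        exact ENNReal.rpow_le_rpow (setLIntegral_le_lintegral _ _) (one_div_nonneg.2 hq.le)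
    _ ≤ C * ∏ i, eLpNorm (f i) (ENNReal.ofReal (P i)) (weightMeasure (w i)) := h f hdom
    _ ≤ _ := by
        gcongr with i
        exact hnorm i

/-- If the norm inequality holds and a dual weight is not integrable on `Q`, then `v` vanishes
almost everywhere on `Q`: for the truncated dual weights, the left side of the norm inequality
is at least a multiple of the product of their integrals, and the right side contains smaller
powers of these integrals, which tend to infinity. -/
lemma HasNormBound.weightMeasure_eq_zero {C : ℝ≥0∞} (h : HasNormBound α P q w v C) (hC : C ≠ ∞)
    (hP : ∀ i, 1 < P i) (hq : 0 < q) (hγ : 0 ≤ 1 - α / ((m : ℝ) * (n : ℝ)))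
    (hw : ∀ i, IsWeight (w i)) {Q : Set (Fin n → ℝ)}
    (hQ : IsCube Q) {i₀ : Fin m} (htop : ∫⁻ x in Q, dualWeight (P i₀) (w i₀) x = ∞) :
    weightMeasure v Q = 0 := by
  have hP0 (i : Fin m) : 0 < P i := zero_lt_one.trans (hP i)
  have he (i : Fin m) : 0 < 1 - 1 / P i := sub_pos.2 ((div_lt_one (hP0 i)).2 (hP i))
  set G : ℕ → Fin m → (Fin n → ℝ) → ℝ≥0∞ :=
    fun k i x => min (dualWeight (P i) (w i) x) ((k + 1 : ℕ) : ℝ≥0∞) with hG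
  have hGm (k i) : AEMeasurable (G k i) volume :=
    ((hw i).aemeasurable_dualWeight (P i)).min aemeasurable_const
  set S : ℕ → Fin m → ℝ≥0∞ := fun k i => ∫⁻ x in Q, G k i x with hS
  have hSt (k i) : S k i ≠ ∞ := by
    refine ne_top_of_le_ne_top (b := ((k + 1 : ℕ) : ℝ≥0∞) * volume Q)
      (ENNReal.mul_ne_top (ENNReal.natCast_ne_top _) hQ.volume_ne_top) ?_
    rw [← setLIntegral_const]
    exact lintegral_mono fun x => min_le_right _ _
  have hGmono (i x) : Monotone fun k => G k i x := fun k l hkl =>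
    min_le_min_left _ (by exact_mod_cast Nat.succ_le_succ hkl)
  have hSmono (i) : Monotone fun k => S k i := fun k l hkl =>
    lintegral_mono fun x => hGmono i x hkl
  have hS0 (k i) : S k i ≠ 0 := by
    intro h0
    rw [hS, lintegral_eq_zero_iff' (hGm k i).restrict] at h0
    have : ∀ᵐ x ∂volume.restrict Q, False := by
      filter_upwards [h0] with x hx
      rcases min_choice (dualWeight (P i) (w i) x) ((k + 1 : ℕ) : ℝ≥0∞) with h | h
      · exact dualWeight_ne_zero (hP i) (w i) x (h.symm.trans hx)
      · exact Nat.cast_ne_zero.2 k.succ_ne_zero (h.symm.trans hx)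
    rw [Filter.eventually_false_iff_eq_bot, ae_eq_bot, Measure.restrict_eq_zero] at this
    exact hQ.volume_ne_zero this
  have hlim : Filter.Tendsto (fun k => S k i₀) Filter.atTop (nhds ∞) := by
    rw [← htop]
    refine lintegral_tendsto_of_tendsto_of_monotone (fun k => (hGm k i₀).restrict)
      (.of_forall (hGmono i₀)) (.of_forall fun x => ?_)
    have := (tendsto_const_nhds (x := dualWeight (P i₀) (w i₀) x)).min
      (ENNReal.tendsto_nat_nhds_top.comp (Filter.tendsto_add_atTop_nat 1))
    rwa [min_eq_left le_top] at this
  set γ := 1 - α / ((m : ℝ) * (n : ℝ)) with hγd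
  set V := cubeFactor m γ Q * weightMeasure v Q ^ (1 / q) with hV
  have bound (k) : (∏ i, S k i ^ (1 - 1 / P i)) * V ≤ C := by
    have h1 := h.setLIntegral_fracMaximal_le hP hq hw hQ (G k) (hGm k)
      (fun i x => min_le_left _ _) (hSt k)
    have h2 : cubeFactor m γ Q * (∏ i, S k i) * weightMeasure v Q ^ (1 / q) ≤
        C * ∏ i, S k i ^ (1 / P i) := by
      refine le_trans ?_ h1
      calc _ = (∫⁻ x in Q, (cubeFactor m γ Q * ∏ i, S k i) ^ q ∂weightMeasure v) ^ (1 / q) := by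
            rw [setLIntegral_const, ENNReal.mul_rpow_of_nonneg _ _ (one_div_nonneg.2 hq.le),
              ← ENNReal.rpow_mul, mul_one_div_cancel hq.ne', ENNReal.rpow_one]
        _ ≤ _ := by
            refine ENNReal.rpow_le_rpow (setLIntegral_mono' hQ.measurableSet fun x hx => ?_)
              (one_div_nonneg.2 hq.le)
            gcongr
            refine le_trans (le_of_eq ?_) (le_fracMaximal α _ hQ hx)
            simp_rw [setLIntegral_indicator_self hQ.measurableSet]
            rfl
    have h3 : ∏ i, S k i = (∏ i, S k i ^ (1 - 1 / P i)) * ∏ i, S k i ^ (1 / P i) := by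
      rw [← Finset.prod_mul_distrib]
      congr 1 with i
      rw [← ENNReal.rpow_add _ _ (hS0 k i) (hSt k i), sub_add_cancel, ENNReal.rpow_one]
    have hD0 : ∏ i, S k i ^ (1 / P i) ≠ 0 := Finset.prod_ne_zero_iff.2 fun i _ =>
      (ENNReal.rpow_pos (pos_iff_ne_zero.2 (hS0 k i)) (hSt k i)).ne'
    have hDt : ∏ i, S k i ^ (1 / P i) ≠ ∞ := ENNReal.prod_ne_top fun i _ =>
      ENNReal.rpow_ne_top_of_nonneg (one_div_nonneg.2 (hP0 i).le) (hSt k i)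
    refine (ENNReal.mul_le_mul_iff_left hD0 hDt).1 (le_trans (le_of_eq ?_) h2)
    rw [h3, hV]; ring
  -- All factors but the one with index `i₀` are bounded below by their values at `k = 0`.
  set W := (∏ i ∈ Finset.univ.erase i₀, S 0 i ^ (1 - 1 / P i)) * V with hW
  have bound' (k) : S k i₀ ^ (1 - 1 / P i₀) * W ≤ C := by
    refine le_trans ?_ (bound k)
    rw [hW, ← mul_assoc, ← Finset.mul_prod_erase _ _ (Finset.mem_univ i₀)]
    gcongr with i
    · exact (he i).le
    · exact hSmono i (Nat.zero_le k)
  by_contra hv0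
  have hW0 : W ≠ 0 := by
    refine mul_ne_zero (Finset.prod_ne_zero_iff.2 fun i _ =>
      (ENNReal.rpow_pos (pos_iff_ne_zero.2 (hS0 0 i)) (hSt 0 i)).ne') (mul_ne_zero ?_ ?_)
    · exact pow_ne_zero _ (ENNReal.inv_ne_zero.2
        (ENNReal.rpow_ne_top_of_nonneg hγ hQ.volume_ne_top))
    · rw [Ne, ENNReal.rpow_eq_zero_iff_of_pos (one_div_pos.2 hq)]
      exact hv0
  have hlim' : Filter.Tendsto (fun k => S k i₀ ^ (1 - 1 / P i₀) * W) Filter.atTop (nhds ∞) := by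
    have := ENNReal.Tendsto.mul_const (b := W)
      ((ENNReal.continuous_rpow_const (y := 1 - 1 / P i₀)).tendsto ∞ |>.comp hlim)
      (.inl (by rw [ENNReal.top_rpow_of_pos (he i₀)]; exact ENNReal.top_ne_zero))
    rwa [ENNReal.top_rpow_of_pos (he i₀), ENNReal.top_mul hW0] at this
  exact hC (top_le_iff.1 (le_of_tendsto' hlim' bound'))

theorem sawyerConst_le_of_hasNormBound {C : ℝ≥0∞} (h : HasNormBound α P q w v C)
    (hP : ∀ i, 1 < P i) (hq : 0 < q) (hγ : 0 ≤ 1 - α / ((m : ℝ) * (n : ℝ)))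
    (hw : ∀ i, IsWeight (w i)) (hv : IsWeight v) :
    sawyerConst α P q w v ≤ C := by
  rcases eq_or_ne C ∞ with rfl | hC
  · exact le_top
  refine iSup₂_le fun Q hQ => ?_
  by_cases hσ : ∀ i, ∫⁻ x in Q, dualWeight (P i) (w i) x ≠ ∞
  · have hD0 : testDen P w Q ≠ 0 := Finset.prod_ne_zero_iff.2 fun i _ =>
      (ENNReal.rpow_pos (pos_iff_ne_zero.2
        (setLIntegral_dualWeight_ne_zero (hP i) (hw i) hQ.volume_ne_zero)) (hσ i)).ne'
    have hDt : testDen P w Q ≠ ∞ := ENNReal.prod_ne_top fun i _ =>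
      ENNReal.rpow_ne_top_of_nonneg (one_div_nonneg.2 (by linarith [hP i])) (hσ i)
    have hle : testNum α P q w v Q ≤ C * testDen P w Q := by
      rw [testNum_eq hv hQ]
      exact h.setLIntegral_fracMaximal_le hP hq hw hQ _
        (fun i => (hw i).aemeasurable_dualWeight (P i)) (fun i x => le_rfl) hσ
    rw [if_neg (ne_top_of_le_ne_top (ENNReal.mul_ne_top hC hDt) hle)]
    exact (ENNReal.div_le_iff hD0 hDt).2 hle
  · push Not at hσ
    obtain ⟨i, hi⟩ := hσ
    have h0 : testNum α P q w v Q = 0 := by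
      rw [testNum_eq hv hQ, Measure.restrict_eq_zero.2
        (h.weightMeasure_eq_zero hC hP hq hγ hw hQ hi), lintegral_zero_measure,
        ENNReal.zero_rpow_of_pos (one_div_pos.2 hq)]
    rw [h0, if_neg ENNReal.zero_ne_top, ENNReal.zero_div]
    exact zero_le

end Necessity

end MultilinearSawyer

theorem theorem1 {n m : ℕ} (α : ℝ) (P : Fin m → ℝ) (p q : ℝ)
    (hα0 : 0 ≤ α) (hα : α < (m : ℝ) * (n : ℝ))
    (hP : ∀ i, 1 < P i)
    (hp : 1 / p = ∑ i, 1 / P i)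
    (hq : 1 / q = 1 / p - α / (n : ℝ))
    (hqP : ∀ i, P i ≤ q) :
    ∃ c C : ℝ≥0, 0 < c ∧ 0 < C ∧
      ∀ (w : Fin m → (Fin n → ℝ) → ℝ) (v : (Fin n → ℝ) → ℝ),
        (∀ i, MultilinearSawyer.IsWeight (w i)) → MultilinearSawyer.IsWeight v →
        (MultilinearSawyer.IsBoundedMaximal α P q w v ↔
          MultilinearSawyer.sawyerConst α P q w v < ∞) ∧
        (c : ℝ≥0∞) * MultilinearSawyer.sawyerConst α P q w v ≤
          MultilinearSawyer.maximalNorm α P q w v ∧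
        MultilinearSawyer.maximalNorm α P q w v ≤
          (C : ℝ≥0∞) * MultilinearSawyer.sawyerConst α P q w v := by
  open MultilinearSawyer in
  have hmn : 0 < (m : ℝ) * (n : ℝ) := hα0.trans_lt hα
  have : NeZero m := ⟨by rintro rfl; simp at hmn⟩
  have hq0 : 0 < q := (zero_lt_one.trans (hP 0)).trans_le (hqP 0)
  have hγ : 0 ≤ 1 - α / ((m : ℝ) * (n : ℝ)) := sub_nonneg.2 ((div_le_one hmn).2 hα.le)
  have hK := upperConst_ne_top (n := n) (α := α) hP hq0 hγ
  -- The constant is increased by one to make it positive, as needed if the testing constant is `∞`.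
  refine ⟨1, (upperConst n α P q).toNNReal + 1, one_pos, by positivity, fun w v hw hv => ?_⟩
  have hle : upperConst n α P q ≤ (((upperConst n α P q).toNNReal + 1 : ℝ≥0) : ℝ≥0∞) := by
    rw [ENNReal.coe_add, ENNReal.coe_toNNReal hK]
    exact le_self_add
  refine ⟨⟨fun ⟨_, C, hC⟩ => ?_, fun hA => ?_⟩, ?_, ?_⟩
  · exact (sawyerConst_le_of_hasNormBound hC hP hq0 hγ hw hv).trans_lt ENNReal.coe_lt_top
  · have hb := hasNormBound_of_sawyerConst_ne_top hP hqP hγ hw hv hA.ne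
    have hfin := ENNReal.mul_ne_top hK hA.ne
    refine ⟨fun f hf => ⟨(measurable_fracMaximal α f).aestronglyMeasurable, ?_⟩,
      (upperConst n α P q * sawyerConst α P q w v).toNNReal, ?_⟩
    · exact (hb f hf).trans_lt
        (ENNReal.mul_lt_top hfin.lt_top (ENNReal.prod_lt_top fun i _ => (hf i).2.2))
    · rwa [ENNReal.coe_toNNReal hfin]
  · rw [ENNReal.coe_one, one_mul]
    exact le_sInf fun C hC => sawyerConst_le_of_hasNormBound hC hP hq0 hγ hw hv
  · rcases eq_or_ne (sawyerConst α P q w v) ∞ with hA | hA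
    · rw [hA, ENNReal.mul_top (by positivity)]
      exact le_top
    · exact (sInf_le (hasNormBound_of_sawyerConst_ne_top hP hqP hγ hw hv hA)).trans (by gcongr)
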